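/- **Theorem 3.8.** Let $(X,d)$ be a hyperbolic metric space which is a tree $(T)$ of hyperbolic metric spaces satisfying the quasi-isometrically embedded condition, and let $v$ be a vertex of $T$. Then the inclusion $i_v : X_v \to X$ extends to a continuous map $\widehat{i_v} : \widehat{X_v}\to\widehat{X}$ between the Gromov compactifications of $(X_v,d_v)$ and $(X,d)$ (a Cannon–Thurston map). Here the following terms are used. *Hyperbolic spaces.* With the Gromov product $(a,b)_c=\frac12\,[d(a,c)+d(b,c)-d(a,b)]$, a metric space is *$\delta$-hyperbolic* if any two of its points are joined by a geodesic segment and $(x,z)_w\ge\min\{(x,y)_w,(y,z)_w\}-\delta$ for all points $w,x,y,z$; it is *hyperbolic* if it is $\delta$-hyperbolic for some $\delta$. The Gromov boundary $\partial Y$ of a hyperbolic space $Y$ is the set of classes of sequences with $(x_m,x_n)_w\to\infty$ as $m,n\to\infty$, where $(x_n)\sim(y_n)$ if $(x_m,y_n)_w\to\infty$ as $m,n\to\infty$. The Gromov compactification is $\widehat Y=Y\cup\partial Y$, in which $Y$ is open with its metric topology and the sets $\{z\in\widehat Y : (z,\xi)_w>r\}$, $r\in\mathbb R$, form a neighbourhood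 basis of $\xi\in\partial Y$; here $(a,b)_w=\sup\liminf_{m,n\to\infty}(x_m,y_n)_w$ for $a,b\in\widehat Y$, the supremum being over the sequences $(x_m)$, $(y_n)$ representing $a$, $b$ (a point of $Y$ is represented by the constant sequence). For proper $Y$ this is the usual compactification by classes of geodesic rays; properness is not assumed. *Quasi-isometric embeddings.* A map $f$ between metric spaces is a *$(K,\epsilon)$-quasi-isometric embedding* if $\frac1K d(y_1,y_2)-\epsilon\le d(f(y_1),f(y_2))\le K d(y_1,y_2)+\epsilon$ for all $y_1,y_2$. *Trees of spaces.* Let $T$ be the geometric realization of a simplicial tree, with edges of length $1$. A metric space $(X,d)$ is a *tree $(T)$ of hyperbolic metric spaces satisfying the quasi-isometrically embedded condition* if there are a continuous surjection $P : X\to T$ and constants $\delta,\epsilon,K>0$ such that: 1. For every vertex $v$ of $T$, $X_v=P^{-1}(v)$ with the path metric $d_v$ induced by $d$ is $\delta$-hyperbolic. The inclusions $i_v:X_v\to X$ are uniformly proper: for every $M>0$ there is $N>0$ such that for all vertices $v$ and all $x,y\in X_v$, $d(x,y)\le M$ implies $d_v(x,y)\le N$. 2. For every edge $e$ of $T$,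 the preimage $X_e$ of the midpoint of $e$ under $P$, with its induced path metric $d_e$, is $\delta$-hyperbolic. 3. For every edge $e$ with initial vertex $v_1$ and final vertex $v_2$ there is a continuous map $f_e: X_e\times[0,1]\to X$ such that $P(f_e(x,t))$ is the point at distance $t$ from $v_1$ on $e$, and $f_e|_{X_e\times(0,1)}$ is an isometry from $X_e\times(0,1)$ with the product metric $\sqrt{d_e(x,y)^2+|s-t|^2}$ onto the preimage of the interior of $e$ with its induced path metric. 4. $f_e|_{X_e\times\{0\}}$ and $f_e|_{X_e\times\{1\}}$ are $(K,\epsilon)$-quasi-isometric embeddings of $(X_e,d_e)$ into $(X_{v_1},d_{v_1})$ and $(X_{v_2},d_{v_2})$ respectively. -/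

import Mathlib

open Set Filter Topology
open scoped ENNReal unitInterval

noncomputable section

/-! ## Hyperbolic spaces

Everything is stated for extended metric spaces, so that it applies both to a metric space and to
a subset with its induced path metric. A geodesic space in the sense below has finite distances. -/

section Hyperbolic

variable {Y : Type*} [EMetricSpace Y]

/-- The real-valued distance (equal to `dist` in a metric space). -/
def rdist (x y : Y) : ℝ := (edist x y).toReal

/-- The Gromov inner product `(a, b)_c = (d(a,c) + d(b,c) - d(a,b)) / 2`. -/
def gromovProduct (c a b : Y) : ℝ := (rdist a c + rdist b c - rdist a b) / 2

variable (Y) in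
/-- Any two points are joined by a geodesic segment, that is, by an isometric copy of `[0, L]`. -/
def IsGeodesicSpace : Prop :=
  ∀ x y : Y, ∃ L : ℝ, 0 ≤ L ∧ ∃ γ : ℝ → Y, γ 0 = x ∧ γ L = y ∧
    ∀ s ∈ Icc 0 L, ∀ t ∈ Icc 0 L, edist (γ s) (γ t) = ENNReal.ofReal |s - t|

variable (Y) in
/-- A `δ`-hyperbolic (geodesic) metric space in the sense of Gromov. -/
structure IsHyperbolicSpace (δ : ℝ) : Prop where
  geodesic : IsGeodesicSpace Y
  four_point : ∀ w x y z : Y,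
    min (gromovProduct w x y) (gromovProduct w y z) - δ ≤ gromovProduct w x z

variable (Y) in
/-- Sequences converging to infinity: `(x_m, x_n)_w → ∞` as `m, n → ∞`. -/
def GromovSequence : Type _ :=
  {x : ℕ → Y // ∀ w, Tendsto (fun p : ℕ × ℕ => gromovProduct w (x p.1) (x p.2)) atTop atTop}

/-- Equivalence of sequences converging to infinity: `(x_m, y_n)_w → ∞` as `m, n → ∞`. In a
hyperbolic space this is an equivalence relation. -/
def GromovSequence.Equivalent (x y : GromovSequence Y) : Prop :=
  ∀ w, Tendsto (fun p : ℕ × ℕ => gromovProduct w (x.1 p.1) (y.1 p.2)) atTop atTop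

variable (Y) in
/-- The Gromov boundary: equivalence classes of sequences converging to infinity. -/
def GromovBoundary : Type _ := Quot (GromovSequence.Equivalent (Y := Y))

variable (Y) in
/-- The Gromov compactification `Y ∪ ∂Y` (as a set). -/
inductive GromovCompactification : Type _
  | of (y : Y) : GromovCompactification
  | bdry (ξ : GromovBoundary Y) : GromovCompactification

namespace GromovCompactification

/-- The sequences used to represent a point of `Y ∪ ∂Y`: for a point of `Y` the constant sequence,
for a boundary point the sequences in its class. -/
def Represents (x : ℕ → Y) : GromovCompactification Y → Prop
  | of y => ∀ n, x n = y
  | bdry ξ => ∃ s : GromovSequence Y, s.1 = x ∧ (Quot.mk _ s : GromovBoundary Y) = ξ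

/-- The Gromov product extended to `Y ∪ ∂Y`: `(a, b)_w = sup liminf_{m, n} (x_m, y_n)_w`, the
supremum over all sequences `x` representing `a` and `y` representing `b`. -/
def product (w : Y) (a b : GromovCompactification Y) : EReal :=
  ⨆ (x : ℕ → Y) (_ : Represents x a) (y : ℕ → Y) (_ : Represents y b),
    liminf (fun p : ℕ × ℕ => ((gromovProduct w (x p.1) (y p.2) : ℝ) : EReal)) atTop

/-- The usual topology of `Y ∪ ∂Y`: `Y` is open and carries its metric topology, and the sets
`{z | (z, ξ)_w > r}`, `r ∈ ℝ`, form a basis of neighbourhoods of `ξ ∈ ∂Y`. -/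
instance : TopologicalSpace (GromovCompactification Y) where
  IsOpen U := IsOpen {y : Y | of y ∈ U} ∧
    ∀ ξ, bdry ξ ∈ U → ∀ w, ∃ r : ℝ, ∀ z, (r : EReal) < product w z (bdry ξ) → z ∈ U
  isOpen_univ := ⟨by simp, fun _ _ _ => ⟨0, fun _ _ => mem_univ _⟩⟩
  isOpen_inter := by
    rintro U U' ⟨h, k⟩ ⟨h', k'⟩
    refine ⟨h.inter h', fun ξ hξ w => ?_⟩
    obtain ⟨r, hr⟩ := k ξ hξ.1 w
    obtain ⟨r', hr'⟩ := k' ξ hξ.2 w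
    refine ⟨max r r', fun z hz => ⟨hr z (lt_of_le_of_lt ?_ hz), hr' z (lt_of_le_of_lt ?_ hz)⟩⟩
    · exact EReal.coe_le_coe_iff.2 (le_max_left _ _)
    · exact EReal.coe_le_coe_iff.2 (le_max_right _ _)
  isOpen_sUnion := by
    intro S hS
    constructor
    · have : {y : Y | of y ∈ ⋃₀ S} = ⋃ U ∈ S, {y : Y | of y ∈ U} := by
        ext y; simp
      rw [this]
      exact isOpen_biUnion fun U hU => (hS U hU).1
    · rintro ξ ⟨U, hU, hξ⟩ w
      obtain ⟨r, hr⟩ := (hS U hU).2 ξ hξ w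
      exact ⟨r, fun z hz => ⟨U, hU, hr z hz⟩⟩

end GromovCompactification

/-- A Cannon–Thurston map for `i : Y → X`: a continuous extension of `i` to a map from `Y ∪ ∂Y`
to `X ∪ ∂X`. -/
def HasCannonThurstonMap {X : Type*} [EMetricSpace X] (i : Y → X) : Prop :=
  ∃ ihat : GromovCompactification Y → GromovCompactification X,
    Continuous ihat ∧ ∀ y, ihat (.of y) = .of (i y)

/-- `(K, ε)`-quasi-isometric embeddings. -/
def IsQIEmbedding {Z : Type*} [EMetricSpace Z] (K ε : ℝ) (f : Y → Z) : Prop :=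
  ∀ y₁ y₂, 1 / K * rdist y₁ y₂ - ε ≤ rdist (f y₁) (f y₂) ∧
    rdist (f y₁) (f y₂) ≤ K * rdist y₁ y₂ + ε

end Hyperbolic

/-! ## The induced path metric on a subset -/

section PathMetric

variable {X : Type*} [MetricSpace X]

/-- The infimum of the lengths of the paths from `x` to `y` inside `S` (`∞` if there is none). -/
def pathEDist (S : Set X) (x y : X) : ℝ≥0∞ :=
  ⨅ (γ : Path x y) (_ : ∀ t, γ t ∈ S), eVariationOn γ univ

theorem edist_le_pathEDist (S : Set X) (x y : X) : edist x y ≤ pathEDist S x y := by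
  refine le_iInf₂ fun γ _ => ?_
  simpa using eVariationOn.edist_le (f := (γ : I → X)) (mem_univ 0) (mem_univ 1)

theorem pathEDist_self {S : Set X} {x : X} (hx : x ∈ S) : pathEDist S x x = 0 := by
  refine le_antisymm ?_ bot_le
  refine iInf₂_le_of_le (Path.refl x) (fun _ => hx) ?_
  rw [eVariationOn.constant_on]
  rintro _ ⟨a, -, rfl⟩ _ ⟨b, -, rfl⟩
  simp

theorem pathEDist_comm_le (S : Set X) (x y : X) : pathEDist S x y ≤ pathEDist S y x := by
  refine le_iInf₂ fun γ h => ?_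
  refine iInf₂_le_of_le γ.symm (fun t => h _) ?_
  refine eVariationOn.comp_le_of_antitoneOn (γ : I → X) σ (t := univ) (s := univ) ?_
    (mapsTo_univ _ _)
  intro a _ b _ hab
  exact unitInterval.symm_le_symm.2 hab

theorem pathEDist_triangle (S : Set X) (x y z : X) :
    pathEDist S x z ≤ pathEDist S x y + pathEDist S y z := by
  simp only [pathEDist, ENNReal.iInf_add, ENNReal.add_iInf]
  refine le_iInf₂ fun γ' hγ' => le_iInf₂ fun γ hγ => ?_
  refine iInf₂_le_of_le (γ.trans γ') (fun t => ?_) ?_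
  · rw [Path.trans_apply]
    split_ifs
    · exact hγ _
    · exact hγ' _
  let m : I := ⟨1 / 2, by norm_num, by norm_num⟩
  have h := eVariationOn.union (γ.trans γ' : I → X) (s := Iic m) (t := Ici m)
    isGreatest_Iic isLeast_Ici
  rw [Iic_union_Ici] at h
  rw [h]
  have two : (2 : ℝ) * (1 / 2) = 1 := by norm_num
  refine add_le_add ?_ ?_
  · have e : EqOn (γ.trans γ' : I → X) (γ ∘ fun t : I => projIcc 0 1 zero_le_one (2 * (t : ℝ)))
        (Iic m) := by
      intro t ht
      have ht' : (t : ℝ) ≤ 1 / 2 := ht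
      simp only [Path.trans_apply, dif_pos ht', Function.comp]
      rw [projIcc_of_mem]
    rw [eVariationOn.congr e]
    refine eVariationOn.comp_le_of_monotoneOn _ _ (fun a _ b _ hab => ?_) (mapsTo_univ _ _)
    exact monotone_projIcc _ (by have : (a : ℝ) ≤ b := hab; linarith)
  · have e : EqOn (γ.trans γ' : I → X)
        (γ' ∘ fun t : I => projIcc 0 1 zero_le_one (2 * (t : ℝ) - 1)) (Ici m) := by
      intro t ht
      have ht' : 1 / 2 ≤ (t : ℝ) := ht
      rcases ht'.eq_or_lt with h0 | h0
      · simp only [Path.trans_apply, Function.comp, ← h0, two, sub_self]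
        rw [projIcc_of_mem _ (left_mem_Icc.2 zero_le_one)]
        rw [dif_pos le_rfl]
        exact γ.target.trans γ'.source.symm
      · simp only [Path.trans_apply, dif_neg (not_le.2 h0), Function.comp]
        rw [projIcc_of_mem]
    rw [eVariationOn.congr e]
    refine eVariationOn.comp_le_of_monotoneOn _ _ (fun a _ b _ hab => ?_) (mapsTo_univ _ _)
    exact monotone_projIcc _ (by have : (a : ℝ) ≤ b := hab; linarith)

/-- The subset `S` of `X`, as a space in its own right with its induced path metric. -/
@[ext] structure PathSubspace (S : Set X) where
  /-- the underlying point of `X`; as a map this is the inclusion -/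
  incl : X
  mem : incl ∈ S

instance (S : Set X) : EMetricSpace (PathSubspace S) where
  edist x y := pathEDist S x.incl y.incl
  edist_self x := pathEDist_self x.mem
  edist_comm x y := le_antisymm (pathEDist_comm_le S _ _) (pathEDist_comm_le S _ _)
  edist_triangle x y z := pathEDist_triangle S _ _ _
  eq_of_edist_eq_zero {x y} h := by
    have := edist_le_pathEDist S x.incl y.incl
    exact PathSubspace.ext (edist_le_zero.1 (this.trans (le_of_eq h)))

end PathMetric

/-! ## Trees of spaces -/

section Tree

variable {V : Type*}

open Classical in
/-- The point at parameter `t ∈ [0, 1]` on the edge from `v` to `w`, in barycentric coordinates. -/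
def edgePoint (v w : V) (t : ℝ) : V → ℝ := (1 - t) • Pi.single v 1 + t • Pi.single w 1

open Classical in
/-- The vertex `v`, in barycentric coordinates. -/
def vertexPoint (v : V) : V → ℝ := Pi.single v 1

/-- The geometric realization of a graph: its vertices and the points on its edges, in barycentric
coordinates. As a subspace of `V → ℝ` it carries the topology of the metric in which each edge has
length `1`. -/
def Realization (G : SimpleGraph V) : Set (V → ℝ) :=
  {p | (∃ v, p = vertexPoint v) ∨ ∃ v w, G.Adj v w ∧ ∃ t ∈ Icc (0 : ℝ) 1, p = edgePoint v w t}

variable {X : Type*} [MetricSpace X] {G : SimpleGraph V}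

/-- `X_v`, the preimage of the vertex `v`. -/
def vertexSpace (P : X → Realization G) (v : V) : Set X := {x | (P x : V → ℝ) = vertexPoint v}

/-- `X_e`, the preimage of the midpoint of the edge `e` from `v` to `w`. -/
def edgeSpace (P : X → Realization G) (v w : V) : Set X :=
  {x | (P x : V → ℝ) = edgePoint v w (1 / 2)}

/-- The preimage of the interior of the edge from `v` to `w`. -/
def openEdgeSpace (P : X → Realization G) (v w : V) : Set X :=
  {x | ∃ t ∈ Ioo (0 : ℝ) 1, (P x : V → ℝ) = edgePoint v w t}

/-- The map `f : X_e × [0, 1] → X` parametrizes the preimage of the edge `e` from `v` to `w`;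
`f₀` and `f₁` are its restrictions to the two ends, as maps to `X_v` and `X_w`. -/
structure IsEdgeMap (P : X → Realization G) (K ε : ℝ) (v w : V)
    (f : PathSubspace (edgeSpace P v w) × I → X)
    (f₀ : PathSubspace (edgeSpace P v w) → PathSubspace (vertexSpace P v))
    (f₁ : PathSubspace (edgeSpace P v w) → PathSubspace (vertexSpace P w)) : Prop where
  continuous : Continuous f
  /-- `f` is compatible with the projection to the tree -/
  proj : ∀ x t, (P (f (x, t)) : V → ℝ) = edgePoint v w t
  /-- `f` maps `X_e × (0, 1)` onto the preimage of the interior of `e` -/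
  surj : ∀ y ∈ openEdgeSpace P v w, ∃ x, ∃ t : I, (t : ℝ) ∈ Ioo (0 : ℝ) 1 ∧ f (x, t) = y
  /-- `f` is an isometry from `X_e × (0, 1)` with the product metric to the preimage of the
  interior of `e` with the induced path metric -/
  isometry : ∀ x y, ∀ s t : I, (s : ℝ) ∈ Ioo (0 : ℝ) 1 → (t : ℝ) ∈ Ioo (0 : ℝ) 1 →
    pathEDist (openEdgeSpace P v w) (f (x, s)) (f (y, t)) =
      ENNReal.ofReal √(rdist x y ^ 2 + ((s : ℝ) - t) ^ 2)
  left : ∀ x, (f₀ x).incl = f (x, 0)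
  right : ∀ x, (f₁ x).incl = f (x, 1)
  qi_left : IsQIEmbedding K ε f₀
  qi_right : IsQIEmbedding K ε f₁

/-- `P : X → T` makes `X` a tree of hyperbolic metric spaces satisfying the quasi-isometrically
embedded condition, with constants `δ`, `ε`, `K`, where `T` is the realization of `G`. -/
structure IsTreeOfHyperbolicSpacesWith (G : SimpleGraph V) (P : X → Realization G)
    (δ ε K : ℝ) : Prop where
  tree : G.IsTree
  continuous : Continuous P
  surjective : Function.Surjective P
  vertex_hyperbolic : ∀ v, IsHyperbolicSpace (PathSubspace (vertexSpace P v)) δ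
  /-- the inclusions `X_v → X` are uniformly proper -/
  uniformly_proper : ∀ M > (0 : ℝ), ∃ N > (0 : ℝ), ∀ v,
    ∀ x y : PathSubspace (vertexSpace P v), dist x.incl y.incl ≤ M → rdist x y ≤ N
  edge_hyperbolic : ∀ v w, G.Adj v w → IsHyperbolicSpace (PathSubspace (edgeSpace P v w)) δ
  edge_map : ∀ v w, G.Adj v w → ∃ f f₀ f₁, IsEdgeMap P K ε v w f f₀ f₁

/-- A tree of hyperbolic metric spaces satisfying the quasi-isometrically embedded condition. -/
def IsTreeOfHyperbolicSpaces (G : SimpleGraph V) (P : X → Realization G) : Prop :=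
  ∃ δ > (0 : ℝ), ∃ ε > (0 : ℝ), ∃ K > (0 : ℝ), IsTreeOfHyperbolicSpacesWith G P δ ε K

end Tree

end

/-! ### Gromov products, thin triangles, hulls and coarse projections. -/

section HyperbolicGeometry

variable {Y : Type*} [MetricSpace Y]

/-! A map extends to the Gromov compactifications once large Gromov products in the source force
large products of the images (`hasCannonThurstonMap_of_gromovProduct`). So it must be shown that if
geodesics of X_v from x to y stay far from w, then geodesics of X from x to y stay far from w too
(`LadderHyp.exists_le_gromovProduct`).

For S = {x, y} consider the ladder: over v it is the hull of S, and over a child vertex it is the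
hull of the far ends of those edge points whose near ends are close to the rung of the parent. X is
projected to it vertex by vertex: coarsely to the nearest point where the rung is nonempty, and to a
single point, up to bounded error, on each branch beyond an empty rung. Nearest-point projections
coarsely commute with quasi-isometric embeddings (`exists_isLadderStep`), so points at bounded
distance have projections at bounded distance (`LadderHyp.exists_dist_le`). Projecting an X-geodesic
with ends on the ladder gives a chain of linear length inside the ladder, and exponential divergence
then makes the ladder quasiconvex (`exists_quasiconvex_of_chains`), uniformly in S.

Hence an X-geodesic from x to y that passes near w has a ladder point near w. The tree height of
this point is at most its distance to w, and descending costs a bounded amount per level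
(`LadderHyp.exists_dist_le_mul`), so the hull of S comes near w in X, and by uniform properness in
X_v. -/

theorem rdist_eq_dist (x y : Y) : rdist x y = dist x y := by
  simp [rdist, dist_edist]

theorem gromovProduct_eq_dist (c a b : Y) :
    gromovProduct c a b = (dist c a + dist c b - dist a b) / 2 := by
  simp only [gromovProduct, rdist_eq_dist, dist_comm c]

theorem gromovProduct_comm (c a b : Y) : gromovProduct c a b = gromovProduct c b a := by
  simp only [gromovProduct_eq_dist, dist_comm a b]; ring

theorem gromovProduct_nonneg (c a b : Y) : 0 ≤ gromovProduct c a b := by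
  rw [gromovProduct_eq_dist]
  linarith [dist_triangle_left a b c]

theorem gromovProduct_le_dist_left (c a b : Y) : gromovProduct c a b ≤ dist c a := by
  rw [gromovProduct_eq_dist]
  linarith [dist_triangle c a b]

theorem gromovProduct_add_gromovProduct (x a b : Y) :
    gromovProduct a x b + gromovProduct b x a = dist a b := by
  simp only [gromovProduct_eq_dist, dist_comm x, dist_comm b a]; ring

theorem gromovProduct_le_add_dist (a x y z : Y) :
    gromovProduct a x y ≤ gromovProduct a x z + dist y z := by
  simp only [gromovProduct_eq_dist]
  linarith [dist_triangle a z y, dist_triangle x y z, dist_comm y z]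

theorem gromovProduct_le_add_dist_base (a b x y : Y) :
    gromovProduct a x y ≤ gromovProduct b x y + dist a b := by
  simp only [gromovProduct_eq_dist]
  linarith [dist_triangle a b x, dist_triangle a b y]

/-- `p` lies on a geodesic from `a` to `b`. -/
def Between (a p b : Y) : Prop := dist a p + dist p b = dist a b

theorem Between.symm {a p b : Y} (h : Between a p b) : Between b p a := by
  unfold Between at *
  rw [dist_comm b p, dist_comm p a, dist_comm b a]; linarith

theorem between_left (a b : Y) : Between a a b := by simp [Between]

theorem Between.trans_left {a q p b : Y} (h : Between a p b) (h' : Between a q p) :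
    Between a q b := by
  unfold Between at *
  linarith [dist_triangle a q b, dist_triangle q p b]

theorem Between.dist_left_le {a p b : Y} (h : Between a p b) : dist a p ≤ dist a b := by
  unfold Between at h
  linarith [dist_nonneg (x := p) (y := b)]

theorem Between.dist_right_le {a p b : Y} (h : Between a p b) : dist p b ≤ dist a b := by
  unfold Between at h
  linarith [dist_nonneg (x := a) (y := p)]

theorem Between.middle {a p q r b : Y} (h : Between a p b) (hq : Between a q p)
    (hr : Between p r b) : Between q p r := by
  unfold Between at *
  linarith [dist_triangle q p r, dist_triangle a q r, dist_triangle a r b]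

theorem Between.gromovProduct_le {a p b : Y} (h : Between a p b) (c : Y) :
    gromovProduct c a b ≤ dist c p := by
  unfold Between at h
  rw [gromovProduct_eq_dist]
  linarith [dist_triangle c p a, dist_triangle c p b, dist_comm p a]

theorem Between.gromovProduct_left {a p b : Y} (h : Between a p b) :
    gromovProduct a p b = dist a p := by
  unfold Between at h
  rw [gromovProduct_eq_dist]; linarith

theorem Between.gromovProduct_eq_zero {a p b : Y} (h : Between a p b) :
    gromovProduct p a b = 0 := by
  unfold Between at h
  rw [gromovProduct_eq_dist, dist_comm p a]; linarith

theorem IsGeodesicSpace.exists_geodesic (h : IsGeodesicSpace Y) (x y : Y) :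
    ∃ γ : ℝ → Y, γ 0 = x ∧ γ (dist x y) = y ∧
      ∀ s ∈ Icc 0 (dist x y), ∀ t ∈ Icc 0 (dist x y), dist (γ s) (γ t) = |s - t| := by
  obtain ⟨L, hL, γ, h0, h1, hγ⟩ := h x y
  have key : ∀ s ∈ Icc 0 L, ∀ t ∈ Icc 0 L, dist (γ s) (γ t) = |s - t| := by
    intro s hs t ht
    rw [dist_edist, hγ s hs t ht, ENNReal.toReal_ofReal (abs_nonneg _)]
  have hd : dist x y = L := by
    rw [← h0, ← h1, key 0 ⟨le_rfl, hL⟩ L ⟨hL, le_rfl⟩]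
    simpa using hL
  exact ⟨γ, h0, hd ▸ h1, hd ▸ key⟩

theorem IsGeodesicSpace.exists_between (h : IsGeodesicSpace Y) (x y : Y) {t : ℝ} (ht : 0 ≤ t)
    (ht' : t ≤ dist x y) : ∃ p, Between x p y ∧ dist x p = t := by
  obtain ⟨γ, h0, h1, hγ⟩ := h.exists_geodesic x y
  have a := hγ 0 ⟨le_rfl, dist_nonneg⟩ t ⟨ht, ht'⟩
  have b := hγ t ⟨ht, ht'⟩ _ ⟨dist_nonneg, le_rfl⟩
  rw [h0, zero_sub, abs_neg, abs_of_nonneg ht] at a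
  rw [h1, abs_sub_comm, abs_of_nonneg (by linarith)] at b
  exact ⟨γ t, by unfold Between; linarith, a⟩

variable {δ : ℝ}

theorem IsHyperbolicSpace.mono {δ' : ℝ} (h : IsHyperbolicSpace Y δ) (hδ : δ ≤ δ') :
    IsHyperbolicSpace Y δ' :=
  ⟨h.geodesic, fun w x y z => by linarith [h.four_point w x y z]⟩

theorem IsHyperbolicSpace.le_or_le (h : IsHyperbolicSpace Y δ) (w x y z : Y) :
    gromovProduct w x y ≤ gromovProduct w x z + δ ∨
      gromovProduct w y z ≤ gromovProduct w x z + δ := by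
  rw [← min_le_iff]
  linarith [h.four_point w x y z]

/-- With t = d(w, x'), the products (x', x), (x, y) and (y, y') at w are all at least t, so two
four-point inequalities give (x', y') ≥ t - 2δ, while this product equals t - d(x', y') / 2. -/
theorem IsHyperbolicSpace.dist_le_of_between (h : IsHyperbolicSpace Y δ) (hδ : 0 ≤ δ)
    {w x y x' y' : Y} (hx : Between w x' x) (hy : Between w y' y) (he : dist w x' = dist w y')
    (ht : dist w x' ≤ gromovProduct w x y) : dist x' y' ≤ 4 * δ := by
  have h1 := hx.gromovProduct_left
  have h2 := hy.gromovProduct_left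
  rw [gromovProduct_comm] at h2
  have h3 : gromovProduct w x' y' = dist w x' - dist x' y' / 2 := by
    rw [gromovProduct_eq_dist]; linarith
  rcases h.le_or_le w x' x y' with h4 | h4
  · linarith
  · rcases h.le_or_le w x y y' with h5 | h5 <;> linarith

/-- Triangles are thin, in terms of the position of a point on one side. -/
theorem IsHyperbolicSpace.exists_between_of_le (h : IsHyperbolicSpace Y δ) (hδ : 0 ≤ δ)
    {w x p : Y} (y : Y) (hp : Between w p x) (ht : dist w p ≤ gromovProduct w x y) :
    ∃ q, Between w q y ∧ dist w q = dist w p ∧ dist p q ≤ 4 * δ := by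
  obtain ⟨q, hq, e⟩ := h.geodesic.exists_between w y dist_nonneg
    (ht.trans (by rw [gromovProduct_comm]; exact gromovProduct_le_dist_left _ _ _))
  exact ⟨q, hq, e, h.dist_le_of_between hδ hp hq e.symm ht⟩

/-- The products at `x` and at `y` add up to d(x, y), so `z` lies in the initial part of the side
seen from one of its ends. -/
theorem IsHyperbolicSpace.thin (h : IsHyperbolicSpace Y δ) (hδ : 0 ≤ δ) {x y z : Y} (c : Y)
    (hz : Between x z y) : ∃ q, (Between x q c ∨ Between c q y) ∧ dist z q ≤ 4 * δ := by
  have hs := gromovProduct_add_gromovProduct c x y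
  rcases le_total (dist x z) (gromovProduct x y c) with ht | ht
  · obtain ⟨q, hq, -, hd⟩ := h.exists_between_of_le hδ c hz ht
    exact ⟨q, .inl hq, hd⟩
  · obtain ⟨q, hq, -, hd⟩ := h.exists_between_of_le hδ c hz.symm (by
      have := hz
      unfold Between at this
      rw [gromovProduct_comm] at ht
      rw [gromovProduct_comm, dist_comm y z]; linarith)
    exact ⟨q, .inr hq.symm, hd⟩

/-- The three points of a geodesic triangle at the ends of its inscribed tripod. -/
theorem IsHyperbolicSpace.exists_tripod (h : IsHyperbolicSpace Y δ) (hδ : 0 ≤ δ) (x y c : Y) :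
    ∃ z z₁ z₂, Between x z y ∧ Between x z₁ c ∧ Between c z₂ y ∧ dist z z₁ ≤ 4 * δ ∧
      dist z z₂ ≤ 4 * δ ∧ dist c z₁ = gromovProduct c x y := by
  have hs := gromovProduct_add_gromovProduct c x y
  obtain ⟨z, hz, e⟩ := h.geodesic.exists_between x y (gromovProduct_nonneg x y c)
    (gromovProduct_le_dist_left _ _ _)
  obtain ⟨z₁, hz₁, e₁, d₁⟩ := h.exists_between_of_le hδ c hz e.le
  obtain ⟨z₂, hz₂, e₂, d₂⟩ := h.exists_between_of_le hδ c hz.symm (by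
      have := hz
      unfold Between at this
      rw [gromovProduct_comm] at e
      rw [gromovProduct_comm, dist_comm y z]; linarith)
  refine ⟨z, z₁, z₂, hz, hz₁, hz₂.symm, d₁, d₂, ?_⟩
  have h1 := gromovProduct_add_gromovProduct y x c
  unfold Between at hz₁
  rw [gromovProduct_comm c x y, dist_comm]
  linarith

/-- With `Between.gromovProduct_le` this lets a Gromov product be read as the distance to a
geodesic, up to 4δ. -/
theorem IsHyperbolicSpace.exists_between_dist_le (h : IsHyperbolicSpace Y δ) (hδ : 0 ≤ δ)
    (c x y : Y) : ∃ z, Between x z y ∧ dist c z ≤ gromovProduct c x y + 4 * δ := by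
  obtain ⟨z, z₁, -, hz, -, -, d, -, e⟩ := h.exists_tripod hδ x y c
  exact ⟨z, hz, by linarith [dist_triangle_right c z z₁]⟩

/-- The union of the geodesics joining points of `S`. -/
def geodesicHull (S : Set Y) : Set Y := {p | ∃ a ∈ S, ∃ b ∈ S, Between a p b}

theorem subset_geodesicHull (S : Set Y) : S ⊆ geodesicHull S :=
  fun a ha => ⟨a, ha, a, ha, between_left a a⟩

/-- `κ`-quasiconvex sets. -/
def IsQuasiconvex (κ : ℝ) (A : Set Y) : Prop :=
  ∀ a ∈ A, ∀ b ∈ A, ∀ p, Between a p b → ∃ q ∈ A, dist p q ≤ κ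

/-- Cut the quadrilateral p, a, a', p' by the diagonal from `p` to `a'` and use thinness twice; the
other three sides lie in the hull. -/
theorem IsHyperbolicSpace.isQuasiconvex_geodesicHull (h : IsHyperbolicSpace Y δ) (hδ : 0 ≤ δ)
    (S : Set Y) : IsQuasiconvex (8 * δ) (geodesicHull S) := by
  rintro p ⟨a, ha, b, hb, hp⟩ p' ⟨a', ha', b', hb', hp'⟩ z hz
  obtain ⟨q, hq | hq, hd⟩ := h.thin hδ a' hz
  · obtain ⟨r, hr | hr, hd'⟩ := h.thin hδ a hq
    · exact ⟨r, ⟨a, ha, b, hb, hp.trans_left hr.symm⟩, by linarith [dist_triangle z q r]⟩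
    · exact ⟨r, ⟨a, ha, a', ha', hr⟩, by linarith [dist_triangle z q r]⟩
  · exact ⟨q, ⟨a', ha', b', hb', hp'.trans_left hq⟩, by linarith⟩

/-- `a` is a coarse nearest-point projection of `x` to `A`. -/
def IsCoarseProj (c : ℝ) (x : Y) (A : Set Y) (a : Y) : Prop :=
  a ∈ A ∧ ∀ b ∈ A, gromovProduct a x b ≤ c

/-- Coarse projections are coarsely unique: the two products bounded by the hypotheses sum to the
distance. -/
theorem IsCoarseProj.dist_le {c c' : ℝ} {x a a' : Y} {A : Set Y} (h : IsCoarseProj c x A a)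
    (h' : IsCoarseProj c' x A a') : dist a a' ≤ c + c' := by
  rw [← gromovProduct_add_gromovProduct x a a']
  exact add_le_add (h.2 _ h'.1) (h'.2 _ h.1)

theorem IsCoarseProj.of_dist_le {c R : ℝ} {x y a : Y} {A : Set Y} (h : IsCoarseProj c x A a)
    (hR : dist x y ≤ R) : IsCoarseProj (c + R) y A a := by
  refine ⟨h.1, fun b hb => ?_⟩
  have := gromovProduct_le_add_dist a b y x
  rw [gromovProduct_comm a b y, gromovProduct_comm a b x, dist_comm] at this
  linarith [h.2 b hb]

theorem isCoarseProj_self {c : ℝ} (hc : 0 ≤ c) {a : Y} {A : Set Y} (ha : a ∈ A) :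
    IsCoarseProj c a A a :=
  ⟨ha, fun b _ => by simpa [gromovProduct_eq_dist] using hc⟩

/-- Take `a` within 1 of realising the distance from `x` to `A`. A large product (x, b) at `a` would
let one move along [a, b], which stays near `A`, and come substantially closer to `x`. -/
theorem IsHyperbolicSpace.exists_isCoarseProj (h : IsHyperbolicSpace Y δ) (hδ : 0 ≤ δ) {κ : ℝ}
    {A : Set Y} (hA : IsQuasiconvex κ A) (hne : A.Nonempty) (x : Y) :
    ∃ a, IsCoarseProj (1 + 4 * δ + κ) x A a := by
  obtain ⟨a, ha, hxa⟩ := (Metric.infDist_lt_iff hne).1 (lt_add_one (Metric.infDist x A))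
  refine ⟨a, ha, fun b hb => ?_⟩
  obtain ⟨p, hp, e⟩ := h.geodesic.exists_between a b (gromovProduct_nonneg a x b)
    (by rw [gromovProduct_comm]; exact gromovProduct_le_dist_left _ _ _)
  obtain ⟨p', hp', e', d⟩ := h.exists_between_of_le hδ x hp
    (by rw [gromovProduct_comm]; exact e.le)
  obtain ⟨q, hq, hpq⟩ := hA a ha b hb p hp
  unfold Between at hp'
  linarith [Metric.infDist_le_dist_of_mem (x := x) hq, dist_triangle x p q, dist_triangle x p' p,
    dist_comm p p', dist_comm x p', dist_comm a x]

/-- If neither four-point inequality bounds (x, b) directly, then both (b, b₁) and (b, b₂) at `a`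
are at most c + δ. Since `b` is between `b₁` and `b₂`, their sum is at least d(a, b), which
dominates (x, b). -/
theorem IsHyperbolicSpace.isCoarseProj_geodesicHull (h : IsHyperbolicSpace Y δ) (hδ : 0 ≤ δ)
    {c : ℝ} {x a : Y} {S : Set Y} (ha : IsCoarseProj c x S a) :
    IsCoarseProj (2 * c + 2 * δ) x (geodesicHull S) a := by
  have hc : 0 ≤ c := (gromovProduct_nonneg _ _ _).trans (ha.2 a ha.1)
  refine ⟨subset_geodesicHull S ha.1, ?_⟩
  rintro b ⟨b₁, h₁, b₂, h₂, hb⟩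
  have k₁ := ha.2 b₁ h₁
  have k₂ := ha.2 b₂ h₂
  rcases h.le_or_le a x b b₁ with e₁ | e₁
  · linarith
  rcases h.le_or_le a x b b₂ with e₂ | e₂
  · linarith
  have := gromovProduct_le_dist_left a b x
  rw [gromovProduct_comm] at this
  rw [gromovProduct_eq_dist] at e₁ e₂
  unfold Between at hb
  linarith [dist_comm b b₁, dist_triangle_left b₁ b₂ a]

end HyperbolicGeometry

/-! ### Exponential divergence and stability of quasi-geodesics. -/

section Morse

variable {Y : Type*} [MetricSpace Y] {δ : ℝ}

/-- The four-point inequality along a chain of `2 ^ k` steps. -/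
theorem IsHyperbolicSpace.le_gromovProduct_of_chain (h : IsHyperbolicSpace Y δ)
    {w : Y} {m r : ℝ} (hr : 0 ≤ r) (k : ℕ) : ∀ (n : ℕ), n ≤ 2 ^ k → ∀ c : ℕ → Y,
    (∀ i < n, dist (c i) (c (i + 1)) ≤ r) → (∀ i ≤ n, m + r ≤ dist w (c i)) →
    m - k * δ ≤ gromovProduct w (c 0) (c n) := by
  induction k with
  | zero =>
    intro n hn c hc hm
    have h0 := hm 0 (Nat.zero_le _)
    rcases Nat.le_one_iff_eq_zero_or_eq_one.1 (by simpa using hn) with rfl | rfl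
    · rw [gromovProduct_eq_dist, dist_self]; push_cast; linarith
    · rw [gromovProduct_eq_dist]; push_cast
      linarith [hm 1 le_rfl, hc 0 one_pos]
  | succ k ih =>
    intro n hn c hc hm
    have h1 := ih (min n (2 ^ k)) (min_le_right _ _) c
      (fun i hi => hc i (hi.trans_le (min_le_left _ _)))
      (fun i hi => hm i (hi.trans (min_le_left _ _)))
    have h2 := ih (n - min n (2 ^ k)) (by rw [pow_succ] at hn; omega)
      (fun i => c (min n (2 ^ k) + i))
      (fun i hi => by have := hc (min n (2 ^ k) + i) (by omega); simpa [add_assoc] using this)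
      (fun i hi => hm _ (by omega))
    have e : min n (2 ^ k) + (n - min n (2 ^ k)) = n := by omega
    simp only [add_zero, e] at h2
    push_cast
    rcases h.le_or_le w (c 0) (c (min n (2 ^ k))) (c n) with h3 | h3 <;> linarith

/-- A number bounded by its logarithm is bounded. -/
theorem exists_bound_of_log_bound (a b L δ : ℝ) (hδ : 0 ≤ δ) : ∃ M : ℝ, 0 ≤ M ∧ ∀ D : ℝ,
    (∀ k : ℕ, L * D + b ≤ 2 ^ k → D ≤ a + k * δ) → D ≤ M := by
  have hlim : Tendsto (fun k : ℕ => (|L| * (|a| + (k + 1) * δ) + |b|) / 2 ^ k) atTop (𝓝 0) := by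
    have h1 : Tendsto (fun k : ℕ => (k : ℝ) * (1 / 2) ^ k) atTop (𝓝 0) :=
      tendsto_self_mul_const_pow_of_lt_one (by norm_num) (by norm_num)
    have h2 : Tendsto (fun k : ℕ => ((1 : ℝ) / 2) ^ k) atTop (𝓝 0) :=
      tendsto_pow_atTop_nhds_zero_of_lt_one (by norm_num) (by norm_num)
    have h3 := (h1.const_mul (|L| * δ)).add (h2.const_mul (|L| * (|a| + δ) + |b|))
    simp only [mul_zero, add_zero] at h3
    refine h3.congr fun k => ?_
    rw [one_div, inv_pow]
    field_simp
    ring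
  obtain ⟨k₀, hk₀⟩ := eventually_atTop.1 (hlim.eventually (gt_mem_nhds one_pos))
  refine ⟨|a| + (k₀ + 1) * δ, by positivity, fun D hD => ?_⟩
  rcases le_or_gt D 0 with h0 | h0
  · exact h0.trans (by positivity)
  replace h0 := h0.le
  have hex : ∃ k : ℕ, L * D + b ≤ 2 ^ k := by
    obtain ⟨k, hk⟩ := pow_unbounded_of_one_lt (L * D + b) (one_lt_two)
    exact ⟨k, hk.le⟩
  classical
  -- For the least such k, either k ≤ k₀ + 1 and the bound is immediate, or 2 ^ (k - 1) is still
  -- below a linear function of k, which fails past k₀.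
  have hs := Nat.find_spec hex
  have hD' := hD _ hs
  rcases le_or_gt (Nat.find hex) (k₀ + 1) with hle | hlt
  · have : (Nat.find hex : ℝ) ≤ k₀ + 1 := by exact_mod_cast hle
    nlinarith [le_abs_self a]
  · exfalso
    obtain ⟨j, hj⟩ : ∃ j, Nat.find hex = j + 1 := ⟨Nat.find hex - 1, by omega⟩
    have hmin := Nat.find_min hex (m := j) (by omega)
    have hb := hk₀ j (by omega)
    rw [div_lt_one (by positivity)] at hb
    rw [hj] at hD'
    push_cast at hD'
    have h1 : L * D ≤ |L| * D := mul_le_mul_of_nonneg_right (le_abs_self L) h0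
    have h2 : |L| * D ≤ |L| * (|a| + (j + 1) * δ) :=
      mul_le_mul_of_nonneg_left (by linarith [le_abs_self a]) (abs_nonneg L)
    linarith [le_abs_self b]

/-- A subset which is coarsely connected by chains of linearly bounded length is quasiconvex. -/
theorem exists_quasiconvex_of_chains (δ r L : ℝ) (hδ : 0 ≤ δ) (hr : 0 ≤ r) (hL : 0 ≤ L) :
    ∃ D : ℝ, 0 ≤ D ∧ ∀ (Y : Type*) [MetricSpace Y], IsHyperbolicSpace Y δ → ∀ B : Set Y,
      (∀ q ∈ B, ∀ q' ∈ B, ∃ (n : ℕ) (c : ℕ → Y), (n : ℝ) ≤ L * (dist q q' + 1) ∧ c 0 = q ∧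
        c n = q' ∧ (∀ i < n, dist (c i) (c (i + 1)) ≤ r) ∧ ∀ i ≤ n, c i ∈ B) →
      IsQuasiconvex D B := by
  obtain ⟨M, hM0, hM⟩ := exists_bound_of_log_bound (1 + r + 2 * δ) (3 * L) (6 * L) δ hδ
  refine ⟨M + 1, by linarith, fun Y _ h B hB a ha b hb => ?_⟩
  have hne : B.Nonempty := ⟨a, ha⟩
  let S : Set ℝ := (fun p => Metric.infDist p B) '' {p | Between a p b}
  have hSne : S.Nonempty := ⟨_, a, between_left a b, rfl⟩
  have hSb : BddAbove S := by
    refine ⟨dist a b, ?_⟩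
    rintro _ ⟨p, hp, rfl⟩
    exact (Metric.infDist_le_dist_of_mem ha).trans
      (by rw [dist_comm]; exact Between.dist_left_le hp)
  have hS : ∀ p, Between a p b → Metric.infDist p B ≤ sSup S :=
    fun p hp => le_csSup hSb ⟨p, hp, rfl⟩
  have key : sSup S ≤ M := by
    have hD0 : 0 ≤ sSup S := Metric.infDist_nonneg.trans (hS a (between_left a b))
    set D := sSup S with hD
    refine hM D fun k hk => ?_
    -- `p` is nearly the farthest point of the geodesic from `B`: `B` misses the ball of radius D -
    -- 1 about it.
    obtain ⟨_, ⟨p, hp, rfl⟩, hpD⟩ := exists_lt_of_lt_csSup hSne (sub_one_lt D)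
    have hfar : ∀ q ∈ B, D - 1 ≤ dist p q := fun q hq =>
      hpD.le.trans (Metric.infDist_le_dist_of_mem hq)
    -- On each side of `p` step back 2D, or to the endpoint if that is nearer, and jump to `B`.
    -- Being 2D away, the jump of length at most D + 1 stays far from `p` in the sense of the Gromov
    -- product.
    have side : ∀ e ∈ B, ∀ e', Between e p e' → (∀ q, Between e q p → Metric.infDist q B ≤ D) →
        ∃ y, Between e y p ∧ ∃ q ∈ B, D - 1 ≤ gromovProduct p y q ∧ dist p q ≤ 3 * D + 1 := by
      intro e he e' _ hq
      rcases le_or_gt (dist p e) (2 * D) with hle | hgt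
      · refine ⟨e, between_left _ _, e, he, ?_, by linarith⟩
        rw [gromovProduct_eq_dist, dist_self]
        linarith [hfar e he]
      · obtain ⟨y, hy, e1⟩ := h.geodesic.exists_between p e (by linarith : 0 ≤ 2 * D) hgt.le
        obtain ⟨q, hqB, hyq⟩ := (Metric.infDist_lt_iff hne).1
          ((hq y hy.symm).trans_lt (lt_add_one D))
        refine ⟨y, hy.symm, q, hqB, ?_, by linarith [dist_triangle p y q]⟩
        rw [gromovProduct_eq_dist]
        linarith [dist_triangle_right p y q]
    obtain ⟨y, hy, q, hqB, hyq, hq⟩ := side a ha b hp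
      (fun q hq => hS q (hp.trans_left hq))
    obtain ⟨y', hy', q', hqB', hyq', hq'⟩ := side b hb a hp.symm
      (fun q hq => hS q (hp.symm.trans_left hq).symm)
    obtain ⟨n, c, hn, h0, h1, hc, hcB⟩ := hB q hqB q' hqB'
    have hnk : n ≤ 2 ^ k := by
      have : (n : ℝ) ≤ 2 ^ k := by
        refine hn.trans (le_trans ?_ hk)
        have : dist q q' ≤ 6 * D + 2 := by linarith [dist_triangle_left q q' p]
        nlinarith
      exact_mod_cast this
    have hch := h.le_gromovProduct_of_chain (w := p) (m := D - 1 - r) hr k n hnk c hc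
      (fun i hi => by linarith [hfar _ (hcB i hi)])
    rw [h0, h1] at hch
    -- The detour y, q, q', y' has large products at `p` at each stage, yet `p` separates `y` from
    -- `y'`; four-point inequalities bound D by a constant plus k * δ.
    have hz : gromovProduct p y y' = 0 :=
      (hp.middle hy hy'.symm).gromovProduct_eq_zero
    have hk0 : (0 : ℝ) ≤ k * δ := by positivity
    rw [gromovProduct_comm] at hyq'
    rcases h.le_or_le p y q y' with h3 | h3
    · linarith
    · rcases h.le_or_le p q q' y' with h4 | h4 <;> linarith
  intro p hp
  obtain ⟨q, hq, hd⟩ := (Metric.infDist_lt_iff hne).1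
    (((hS p hp).trans key).trans_lt (lt_add_one M))
  exact ⟨q, hq, hd.le⟩

theorem IsQIEmbedding.dist_le {E : Type*} [MetricSpace E] {K ε : ℝ} {f : E → Y}
    (hf : IsQIEmbedding K ε f) (x y : E) : dist (f x) (f y) ≤ K * dist x y + ε := by
  simpa only [rdist_eq_dist] using (hf x y).2

theorem IsQIEmbedding.dist_le_mul {E : Type*} [MetricSpace E] {K ε : ℝ} (hK : 0 < K) {f : E → Y}
    (hf : IsQIEmbedding K ε f) (x y : E) : dist x y ≤ K * (dist (f x) (f y) + ε) := by
  have := (hf x y).1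
  simp only [rdist_eq_dist] at this
  rw [one_div, sub_le_iff_le_add, inv_mul_le_iff₀ hK] at this
  exact this

/-- `D` is a stability constant for the quasi-isometric embedding `f`: geodesics between image
points are close to images of geodesics. -/
def IsStable {E : Type*} [MetricSpace E] (D : ℝ) (f : E → Y) : Prop :=
  ∀ x y z, Between (f x) z (f y) → ∃ s, Between x s y ∧ dist z (f s) ≤ D

/-- The image of a geodesic satisfies the chain condition: subdivide the segment between two
parameters into pieces of length at most 1. Its length is controlled linearly by the distance of the
image points. -/
theorem exists_isStable (δ K ε : ℝ) (hδ : 0 ≤ δ) (hK : 0 < K) (hε : 0 ≤ ε) :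
    ∃ D : ℝ, 0 ≤ D ∧ ∀ (E : Type*) (Y : Type*) [MetricSpace E] [MetricSpace Y],
      IsGeodesicSpace E → IsHyperbolicSpace Y δ → ∀ f : E → Y, IsQIEmbedding K ε f →
      IsStable D f := by
  obtain ⟨D, hD0, hD⟩ := exists_quasiconvex_of_chains δ (K + ε) (K + K * ε + 2) hδ (by positivity)
    (by positivity)
  refine ⟨D, hD0, fun E Y _ _ hE hY f hf x y z hz => ?_⟩
  obtain ⟨γ, h0, h1, hγ⟩ := hE.exists_geodesic x y
  have hB := hD Y hY (f '' (γ '' Icc 0 (dist x y))) (by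
    rintro _ ⟨_, ⟨s, hs, rfl⟩, rfl⟩ _ ⟨_, ⟨t, ht, rfl⟩, rfl⟩
    -- The extra 1 keeps the number of pieces positive when s = t.
    have hn : (0 : ℝ) < (⌈|s - t|⌉₊ + 1 : ℕ) := by positivity
    have hn' : |s - t| ≤ (⌈|s - t|⌉₊ + 1 : ℕ) := by
      push_cast; linarith [Nat.le_ceil |s - t|]
    generalize hN : ⌈|s - t|⌉₊ + 1 = n at *
    have hnle : (n : ℝ) ≤ |s - t| + 2 := by
      rw [← hN]; push_cast; linarith [Nat.ceil_lt_add_one (abs_nonneg (s - t))]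
    have hmem : ∀ i ≤ n, s + (i / n : ℝ) * (t - s) ∈ Icc 0 (dist x y) := by
      intro i hi
      have h2 : (i / n : ℝ) ≤ 1 := by rw [div_le_one hn]; exact_mod_cast hi
      have h3 : (0 : ℝ) ≤ i / n := by positivity
      have := (convex_Icc 0 (dist x y)) hs ht (sub_nonneg.2 h2) h3 (by ring)
      simp only [smul_eq_mul] at this
      convert this using 1; ring
    refine ⟨n, fun i => f (γ (s + (i / n : ℝ) * (t - s))), ?_, by simp, ?_, fun i hi => ?_,
      fun i hi => ⟨_, ⟨_, hmem i hi, rfl⟩, rfl⟩⟩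
    · have := hf.dist_le_mul hK (γ s) (γ t)
      rw [hγ s hs t ht] at this
      have h5 := dist_nonneg (x := f (γ s)) (y := f (γ t))
      nlinarith [mul_nonneg (mul_nonneg hK.le hε) h5]
    · simp only [div_self hn.ne', one_mul, add_sub_cancel]
    · refine (hf.dist_le _ _).trans ?_
      rw [hγ _ (hmem i hi.le) _ (hmem (i + 1) hi)]
      have : |s + (i / n : ℝ) * (t - s) - (s + ((i + 1 : ℕ) / n : ℝ) * (t - s))|
          = |s - t| / n := by
        rw [show s + (i / n : ℝ) * (t - s) - (s + ((i + 1 : ℕ) / n : ℝ) * (t - s))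
          = (s - t) / n by push_cast; field_simp; ring, abs_div, Nat.abs_cast]
      rw [this]
      have : |s - t| / n ≤ 1 := by rw [div_le_one hn]; exact hn'
      nlinarith)
  obtain ⟨_, ⟨_, ⟨s, hs, rfl⟩, rfl⟩, hd⟩ := hB (f x)
    ⟨x, ⟨0, ⟨le_rfl, dist_nonneg⟩, h0⟩, rfl⟩ (f y) ⟨y, ⟨_, ⟨dist_nonneg, le_rfl⟩, h1⟩, rfl⟩ z hz
  refine ⟨γ s, ?_, hd⟩
  have a := hγ 0 ⟨le_rfl, dist_nonneg⟩ s hs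
  have b := hγ s hs _ ⟨dist_nonneg, le_rfl⟩
  rw [h0, zero_sub, abs_neg, abs_of_nonneg hs.1] at a
  rw [h1, abs_sub_comm, abs_of_nonneg (by linarith [hs.2])] at b
  unfold Between; linarith

variable {E : Type*} [MetricSpace E] {K ε D : ℝ} {f : E → Y}

/-- Images of geodesics are close to geodesics. -/
theorem IsStable.gromovProduct_le_of_between (hs : IsStable D f) (hY : IsHyperbolicSpace Y δ)
    (hδ : 0 ≤ δ) (hK : 0 < K) (hf : IsQIEmbedding K ε f) {x s y : E} (hb : Between x s y) :
    gromovProduct (f s) (f x) (f y) ≤ K * (K * (2 * D + 8 * δ + ε)) + ε + D + 4 * δ := by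
  obtain ⟨z, z₁, z₂, hz, hz₁, hz₂, d₁, d₂, -⟩ := hY.exists_tripod hδ (f x) (f y) (f s)
  -- Stability on both legs of the tripod gives `s₁` before and `s₂` after `s`, with nearby images.
  -- Hence `s₁` and `s₂` are close, and `s` lies between them.
  obtain ⟨s₁, hs₁, e₁⟩ := hs _ _ _ hz₁
  obtain ⟨s₂, hs₂, e₂⟩ := hs _ _ _ hz₂
  have h1 : dist (f s₁) (f s₂) ≤ 2 * D + 8 * δ := by
    linarith [dist_triangle (f s₁) z₁ (f s₂), dist_triangle z₁ z (f s₂), dist_triangle z z₂ (f s₂),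
      dist_comm (f s₁) z₁, dist_comm z₁ z]
  have h2 : dist s s₁ ≤ K * (2 * D + 8 * δ + ε) := by
    have := hf.dist_le_mul hK s₁ s₂
    have h3 := hb.middle hs₁ hs₂
    rw [dist_comm]
    exact (h3.dist_left_le.trans this).trans (by gcongr)
  refine (hz.gromovProduct_le _).trans ?_
  have h3 : dist (f s) (f s₁) ≤ K * (K * (2 * D + 8 * δ + ε)) + ε :=
    (hf.dist_le _ _).trans (by gcongr)
  linarith [dist_triangle (f s) (f s₁) z, dist_triangle (f s₁) z₁ z, dist_comm (f s₁) z₁,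
    dist_comm z₁ z]

end Morse

/-! ### Extending a quasiconvex set across one edge space. -/

section LadderStep

variable {E Y : Type*} [MetricSpace E] [MetricSpace Y] {δ K ε D D' : ℝ} {f : E → Y}

/-- A quasi-isometric embedding with constants for the two halves of the Morse lemma. -/
structure IsMorseEmbedding (K ε D D' : ℝ) (f : E → Y) : Prop where
  qi : IsQIEmbedding K ε f
  stable : IsStable D f
  between : ∀ x s y, Between x s y → gromovProduct (f s) (f x) (f y) ≤ D'

theorem IsMorseEmbedding.gromovProduct_le (hf : IsMorseEmbedding K ε D D' f)
    (hE : IsHyperbolicSpace E δ) (hδ : 0 ≤ δ) (hK : 0 < K) (a x y : E) :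
    gromovProduct (f a) (f x) (f y) ≤ K * (gromovProduct a x y + 4 * δ) + ε + D' := by
  obtain ⟨s, hs, hd⟩ := hE.exists_between_dist_le hδ a x y
  have h1 : dist (f a) (f s) ≤ K * (gromovProduct a x y + 4 * δ) + ε :=
    (hf.qi.dist_le _ _).trans (by gcongr)
  linarith [hf.between x s y hs, gromovProduct_le_add_dist_base (f a) (f s) (f x) (f y)]

theorem IsMorseEmbedding.isCoarseProj_image (hf : IsMorseEmbedding K ε D D' f)
    (hE : IsHyperbolicSpace E δ) (hδ : 0 ≤ δ) (hK : 0 < K) {c : ℝ} {s q : E} {S : Set E}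
    (h : IsCoarseProj c s S q) :
    IsCoarseProj (K * (c + 4 * δ) + ε + D') (f s) (f '' S) (f q) := by
  refine ⟨mem_image_of_mem f h.1, ?_⟩
  rintro _ ⟨b, hb, rfl⟩
  refine (hf.gromovProduct_le hE hδ hK q s b).trans ?_
  have := h.2 b hb
  gcongr

/-- When the two projections are far apart, geodesics from `f s` to `f s'` must pass near `a`, and
stability puts an image point there. -/
theorem IsMorseEmbedding.exists_dist_le_of_lt (hf : IsMorseEmbedding K ε D D' f)
    (hY : IsHyperbolicSpace Y δ) (hδ : 0 ≤ δ) {c : ℝ} {s s' : E} {A : Set Y} {a a' : Y}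
    (h : IsCoarseProj c (f s) A a) (h' : IsCoarseProj c (f s') A a')
    (hd : 2 * c + δ < dist a a') : ∃ t, dist (f t) a ≤ c + 5 * δ + D := by
  have h1 := h.2 a' h'.1
  have h2 := h'.2 a h.1
  have h3 := gromovProduct_add_gromovProduct (f s') a a'
  obtain ⟨z, hz, hz'⟩ := hY.exists_between_dist_le hδ a (f s) (f s')
  obtain ⟨t, -, ht⟩ := hf.stable _ _ _ hz
  refine ⟨t, ?_⟩
  rcases hY.le_or_le a (f s) (f s') a' with h4 | h4
  · linarith [dist_triangle_right (f t) a z, dist_comm z (f t)]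
  · linarith

/-- The points that `f` sends `C`-close to `A`. -/
def nearSet (C : ℝ) (f : E → Y) (A : Set Y) : Set E := {s | ∃ a ∈ A, dist (f s) a ≤ C}

/-- `f p` is near a geodesic from `f x` to `f y`, hence near one of the other sides of the
quadrilateral with vertices f x, a, a', f y. Near [a, a'] it is near `A`, and `C` is large enough to
put `p` itself in the set; otherwise it is near `f x` or `f y`. -/
theorem IsMorseEmbedding.isQuasiconvex_nearSet (hf : IsMorseEmbedding K ε D D' f)
    (hY : IsHyperbolicSpace Y δ) (hδ : 0 ≤ δ) (hK : 0 < K) {κ C : ℝ} (hD : 0 ≤ D')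
    (hε : 0 ≤ ε) {A : Set Y} (hA : IsQuasiconvex κ A) (hC : D' + 12 * δ + κ ≤ C) :
    IsQuasiconvex (K * (D' + 12 * δ + C + ε)) (nearSet C f A) := by
  rintro x ⟨a, ha, hxa⟩ y ⟨a', ha', hya'⟩ p hp
  obtain ⟨z, hz, hpz⟩ := hY.exists_between_dist_le hδ (f p) (f x) (f y)
  have hpD := hf.between x p y hp
  have close : ∀ e ∈ nearSet C f A, dist (f p) (f e) ≤ D' + 12 * δ + C →
      ∃ q ∈ nearSet C f A, dist p q ≤ K * (D' + 12 * δ + C + ε) := fun e he hd =>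
    ⟨e, he, (hf.qi.dist_le_mul hK p e).trans (by gcongr)⟩
  have he : ∀ (q e b z : Y), Between q z b → dist e q ≤ C → e = b →
      dist z e ≤ C := by
    rintro q e b z hz hq rfl
    linarith [hz.dist_right_le, dist_comm e q]
  obtain ⟨q, hq | hq, hzq⟩ := hY.thin hδ a hz
  · have := he a (f x) (f x) q hq.symm hxa rfl
    exact close x ⟨a, ha, hxa⟩
      (by linarith [dist_triangle (f p) z (f x), dist_triangle z q (f x)])
  obtain ⟨r, hr | hr, hqr⟩ := hY.thin hδ a' hq
  · obtain ⟨b, hb, hrb⟩ := hA a ha a' ha' r hr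
    have : p ∈ nearSet C f A := ⟨b, hb, by
      linarith [dist_triangle (f p) z b, dist_triangle z q b, dist_triangle q r b]⟩
    refine ⟨p, this, ?_⟩
    rw [dist_self]
    have : 0 ≤ C := dist_nonneg.trans hxa
    positivity
  · have := he a' (f y) (f y) r hr hya' rfl
    exact close y ⟨a', ha', hya'⟩ (by
      linarith [dist_triangle (f p) z (f y), dist_triangle z q (f y), dist_triangle q r (f y)])

/-- If [a, f s] runs along [a, b] for longer than `C`, the place where it branches off is near both
`A` and an image point `f t`. Then `t` belongs to the near set, and the projection property of `q`
bounds how far the branching is from `f q`. -/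
theorem IsMorseEmbedding.isCoarseProj_of_nearSet (hf : IsMorseEmbedding K ε D D' f)
    (hY : IsHyperbolicSpace Y δ) (hδ : 0 ≤ δ) {κ C c : ℝ} (hD : 0 ≤ D) {A : Set Y}
    (hA : IsQuasiconvex κ A) (hC : D + 8 * δ + κ ≤ C) {s q : E}
    (hq : IsCoarseProj c (f s) (f '' nearSet C f A) (f q)) {a : Y} (ha : a ∈ A)
    (hqa : dist (f q) a ≤ C) : IsCoarseProj (c + C + D) (f s) A a := by
  have hc : 0 ≤ c := (gromovProduct_nonneg _ _ _).trans (hq.2 _ hq.1)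
  refine ⟨ha, fun b hb => ?_⟩
  rcases le_or_gt (gromovProduct a (f s) b) C with ht | ht
  · linarith
  obtain ⟨z, hz, e⟩ := hY.geodesic.exists_between a b (gromovProduct_nonneg a (f s) b)
    (by rw [gromovProduct_comm]; exact gromovProduct_le_dist_left _ _ _)
  obtain ⟨z', hz', e', d⟩ := hY.exists_between_of_le hδ (f s) hz
    (by rw [gromovProduct_comm]; exact e.le)
  -- As `z'` is farther from `a` than d(a, f q) ≤ C, it lies on the part of [f s, a] that
  -- fellow-travels [f s, f q].
  obtain ⟨y, hy, e'', d'⟩ := hY.exists_between_of_le hδ (f q) hz'.symm (by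
    unfold Between at hz'
    rw [gromovProduct_eq_dist]
    linarith [dist_comm (f s) z', dist_comm (f s) a, dist_triangle (f s) (f q) a,
      dist_comm a (f q)])
  obtain ⟨t, -, ht'⟩ := hf.stable _ _ _ hy
  obtain ⟨b', hb', hzb⟩ := hA a ha b hb z hz
  have htS : t ∈ nearSet C f A := ⟨b', hb', by
    linarith [dist_triangle (f t) y b', dist_triangle y z' b', dist_triangle z' z b',
      dist_comm (f t) y, dist_comm y z', dist_comm z' z]⟩
  have h1 := hq.2 _ ⟨t, htS, rfl⟩
  have h2 := gromovProduct_le_add_dist (f q) (f s) y (f t)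
  rw [gromovProduct_comm, hy.symm.gromovProduct_left] at h2
  unfold Between at hy hz'
  linarith [dist_comm y (f q), dist_triangle (f s) (f q) a, dist_comm (f s) a, dist_comm (f s) z']

/-- The properties of the two ends `f₀`, `f₁` of an edge space that are used to extend a
quasiconvex set `A` across the edge: the extension is the hull of the image of the points that are
`C`-close to `A`. -/
structure IsLadderStep {Y' : Type*} [MetricSpace Y'] (δ C c : ℝ) (f₀ : E → Y) (f₁ : E → Y') :
    Prop where
  dist_le_of_empty : ∀ A, IsQuasiconvex (8 * δ) A → nearSet C f₀ A = ∅ → ∀ s s' a a',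
    IsCoarseProj (1 + 12 * δ) (f₀ s) A a → IsCoarseProj (1 + 12 * δ) (f₀ s') A a' →
    dist a a' ≤ c
  dist_proj_le : ∀ A, IsQuasiconvex (8 * δ) A → ∀ s a a',
    IsCoarseProj (1 + 12 * δ) (f₀ s) A a →
    IsCoarseProj (1 + 12 * δ) (f₁ s) (geodesicHull (f₁ '' nearSet C f₀ A)) a' →
    ∃ q, dist a (f₀ q) ≤ c ∧ dist (f₁ q) a' ≤ c
  exists_near : ∀ A, IsQuasiconvex (8 * δ) A → ∀ p ∈ geodesicHull (f₁ '' nearSet C f₀ A),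
    ∃ q ∈ nearSet C f₀ A, dist p (f₁ q) ≤ c

/-- Projecting an edge point to the near set inside the edge space gives, through the two end maps,
the projections on both sides of the edge; the first clause is
`IsMorseEmbedding.exists_dist_le_of_lt`. -/
theorem exists_isLadderStep (δ K ε : ℝ) (hδ : 0 ≤ δ) (hK : 0 < K) (hε : 0 ≤ ε) :
    ∃ C c : ℝ, 0 ≤ C ∧ 0 ≤ c ∧ ∀ (E : Type*) (Y : Type*) (Y' : Type*) [MetricSpace E]
      [MetricSpace Y] [MetricSpace Y'], IsHyperbolicSpace E δ → IsHyperbolicSpace Y δ →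
      IsHyperbolicSpace Y' δ → ∀ (f₀ : E → Y) (f₁ : E → Y'), IsQIEmbedding K ε f₀ →
      IsQIEmbedding K ε f₁ → IsLadderStep δ C c f₀ f₁ := by
  obtain ⟨D₀, hD₀, h₀⟩ := exists_isStable δ K ε hδ hK hε
  -- A second copy, since `Y` and `Y'` may lie in different universes; `D` below dominates both
  -- constants.
  obtain ⟨D₁, hD₁, h₁⟩ := exists_isStable δ K ε hδ hK hε
  obtain ⟨D, hD, hDD⟩ : ∃ D, 0 ≤ D ∧ D₀ ≤ D ∧ D₁ ≤ D :=
    ⟨D₀ + D₁, by positivity, by linarith, by linarith⟩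
  obtain ⟨D', hD', hDD'⟩ : ∃ D', 0 ≤ D' ∧ D' = K * (K * (2 * D + 8 * δ + ε)) + ε + D + 4 * δ :=
    ⟨_, by positivity, rfl⟩
  -- Dominates the three thresholds needed below: 1 + 17δ + D, D' + 20δ and D + 16δ.
  obtain ⟨C, hC⟩ : ∃ C, C = 1 + 32 * δ + D + D' := ⟨_, rfl⟩
  obtain ⟨κ, hκ0, hκ⟩ : ∃ κ, 0 ≤ κ ∧ κ = K * (D' + 12 * δ + C + ε) :=
    ⟨_, by rw [hC]; positivity, rfl⟩
  obtain ⟨c₁, hc₁, hc₁'⟩ : ∃ c₁, 0 ≤ c₁ ∧ c₁ = K * (1 + 4 * δ + κ + 4 * δ) + ε + D' :=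
    ⟨_, by positivity, rfl⟩
  have hC0 : 0 ≤ C := by rw [hC]; positivity
  have hKκ : 0 ≤ K * κ := by positivity
  refine ⟨C, 2 + 25 * δ + (1 + 12 * δ) + 2 * c₁ + 2 * C + D + (2 + 26 * δ) + (D + K * κ + ε), hC0,
    by positivity, fun E Y Y' _ _ _ hE hY hY' f₀ f₁ q₀ q₁ => ?_⟩
  have s₀ : IsStable D f₀ := fun x y z hz =>
    let ⟨s, hs, hd⟩ := h₀ E Y hE.geodesic hY f₀ q₀ x y z hz
    ⟨s, hs, hd.trans hDD.1⟩
  have s₁ : IsStable D f₁ := fun x y z hz =>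
    let ⟨s, hs, hd⟩ := h₁ E Y' hE.geodesic hY' f₁ q₁ x y z hz
    ⟨s, hs, hd.trans hDD.2⟩
  have m₀ : IsMorseEmbedding K ε D D' f₀ :=
    ⟨q₀, s₀, fun x s y h => hDD' ▸ s₀.gromovProduct_le_of_between hY hδ hK q₀ h⟩
  have m₁ : IsMorseEmbedding K ε D D' f₁ :=
    ⟨q₁, s₁, fun x s y h => hDD' ▸ s₁.gromovProduct_le_of_between hY' hδ hK q₁ h⟩
  have qc : ∀ A, IsQuasiconvex (8 * δ) A → IsQuasiconvex κ (nearSet C f₀ A) := fun A hA =>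
    hκ ▸ m₀.isQuasiconvex_nearSet hY hδ hK hD' hε hA (by linarith)
  refine ⟨fun A hA he s s' a a' ha ha' => ?_, fun A hA s a a' ha ha' => ?_, fun A hA p hp => ?_⟩
  · by_contra! hd
    obtain ⟨t, ht⟩ := m₀.exists_dist_le_of_lt hY hδ ha ha' (by linarith)
    have : t ∈ nearSet C f₀ A := ⟨a, ha.1, by linarith⟩
    rw [he] at this
    exact this
  · obtain ⟨_, ⟨s', hs', rfl⟩, -⟩ := ha'.1
    obtain ⟨q, hq⟩ := hE.exists_isCoarseProj hδ (qc A hA) ⟨s', hs'⟩ s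
    have hq₀ := m₀.isCoarseProj_image hE hδ hK hq
    have hq₁ := hY'.isCoarseProj_geodesicHull hδ (m₁.isCoarseProj_image hE hδ hK hq)
    rw [← hc₁'] at hq₀ hq₁
    obtain ⟨b, hb, hqb⟩ := hq.1
    have hb' := m₀.isCoarseProj_of_nearSet hY hδ hD hA (by linarith) hq₀ hb hqb
    refine ⟨q, ?_, ?_⟩
    · linarith [ha.dist_le hb', dist_triangle_right a (f₀ q) b]
    · linarith [hq₁.dist_le ha']
  · obtain ⟨_, ⟨x, hx, rfl⟩, _, ⟨y, hy, rfl⟩, hp⟩ := hp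
    obtain ⟨s, hs, hd⟩ := s₁ x y p hp
    obtain ⟨q, hq, hsq⟩ := qc A hA x hx y hy s hs
    refine ⟨q, hq, ?_⟩
    have : dist (f₁ s) (f₁ q) ≤ K * κ + ε := (q₁.dist_le _ _).trans (by gcongr)
    linarith [dist_triangle p (f₁ s) (f₁ q)]

end LadderStep

/-! ### The ladder and its combinatorics. -/

section Ladder

variable {V : Type*} {G : SimpleGraph V} {X : Type*} {Y : V → Type*}
  [∀ v, MetricSpace (Y v)] {E : ∀ ⦃u w : V⦄, G.Adj u w → Type*}

variable {ι : ∀ v, Y v → X} {f₀ : ∀ ⦃u w⦄ (h : G.Adj u w), E h → Y u}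
  {f₁ : ∀ ⦃u w⦄ (h : G.Adj u w), E h → Y w}

/-- `w` is a child of its neighbour `u` in the tree rooted at `v`. -/
def IsChild (G : SimpleGraph V) (v u w : V) : Prop := G.dist v w = G.dist v u + 1

theorem SimpleGraph.IsTree.exists_parent (hG : G.IsTree) {v w : V} (hw : w ≠ v) :
    ∃ u, G.Adj u w ∧ IsChild G v u w := by
  obtain ⟨p, hp⟩ := hG.connected.exists_walk_length_eq_dist w v
  cases p with
  | nil => exact absurd rfl hw
  | @cons _ u _ h p =>
    refine ⟨u, h.symm, ?_⟩
    have h1 := SimpleGraph.dist_le p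
    rw [SimpleGraph.Walk.length_cons] at hp
    have h2 := hG.dist_eq_dist_add_one_of_adj v h
    rw [SimpleGraph.dist_comm (u := w)] at hp
    rw [SimpleGraph.dist_comm] at h1
    unfold IsChild
    omega

/-- Shortest walks to `u` and `u'`, prolonged to `w`, are both paths from `v` to `w`, so they
coincide. -/
theorem SimpleGraph.IsTree.parent_unique (hG : G.IsTree) {v u u' w : V} (h : G.Adj u w)
    (h' : G.Adj u' w) (hu : IsChild G v u w) (hu' : IsChild G v u' w) : u = u' := by
  obtain ⟨p, hp⟩ := hG.connected.exists_walk_length_eq_dist v u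
  obtain ⟨p', hp'⟩ := hG.connected.exists_walk_length_eq_dist v u'
  have hq := (p.concat h).isPath_of_length_eq_dist (by rw [SimpleGraph.Walk.length_concat, hp, hu])
  have hq' := (p'.concat h').isPath_of_length_eq_dist
    (by rw [SimpleGraph.Walk.length_concat, hp', hu'])
  have e := congrArg SimpleGraph.Walk.penultimate ((hG.existsUnique_path v w).unique hq hq')
  simpa using e

theorem SimpleGraph.IsTree.isChild_or_isChild (hG : G.IsTree) (v : V) {u w : V} (h : G.Adj u w) :
    IsChild G v u w ∨ IsChild G v w u :=
  (hG.dist_eq_dist_add_one_of_adj v h).symm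

variable (ι f₀ f₁)

/-- The ladder over `S ⊆ Y v`: the hull of `S`, extended across the edges away from `v`. -/
inductive Ladder (C : ℝ) {v : V} (S : Set (Y v)) : ∀ u, Y u → Prop
  | root (p : Y v) : p ∈ geodesicHull S → Ladder C S v p
  | step {u w : V} (h : G.Adj u w) (hc : IsChild G v u w) (s s' : E h) (a a' : Y u)
      (ha : Ladder C S u a) (ha' : Ladder C S u a') (hs : dist (f₀ h s) a ≤ C)
      (hs' : dist (f₀ h s') a' ≤ C) (p : Y w) (hp : Between (f₁ h s) p (f₁ h s')) :
      Ladder C S w p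

/-- The rung of the ladder in `Y u`. -/
def rung (C : ℝ) {v : V} (S : Set (Y v)) (u : V) : Set (Y u) := {p | Ladder f₀ f₁ C S u p}

/-- `z` is the point to which the vertex space of `u` is projected, where `u` is beyond the
support of the ladder. -/
inductive Beyond (C c : ℝ) {v : V} (S : Set (Y v)) : V → X → Prop
  | base {u w : V} (h : G.Adj u w) (hc : IsChild G v u w) (he : rung f₀ f₁ C S w = ∅) (s : E h)
      (a : Y u) (ha : IsCoarseProj c (f₀ h s) (rung f₀ f₁ C S u) a) : Beyond C c S w (ι u a)
  | step {u w : V} (h : G.Adj u w) (hc : IsChild G v u w) (z : X) (hz : Beyond C c S u z) :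
      Beyond C c S w z

/-- `z` is a projection of `y` to the ladder. -/
def IsLadderProj (C c : ℝ) {v : V} (S : Set (Y v)) (u : V) (y : Y u) (z : X) : Prop :=
  (∃ a, IsCoarseProj c y (rung f₀ f₁ C S u) a ∧ z = ι u a) ∨ Beyond ι f₀ f₁ C c S u z

variable {ι f₀ f₁} {C c δ : ℝ} {v : V} {S : Set (Y v)}

theorem Ladder.inversion {w : V} {p : Y w} (h : Ladder f₀ f₁ C S w p) :
    (w = v ∧ G.dist v w = 0) ∨ ∃ u, ∃ h : G.Adj u w, IsChild G v u w ∧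
      p ∈ geodesicHull (f₁ h '' nearSet C (f₀ h) (rung f₀ f₁ C S u)) := by
  cases h with
  | root p hp => exact .inl ⟨rfl, by simp⟩
  | step h hc s s' a a' ha ha' hs hs' p hp =>
    exact .inr ⟨_, h, hc, f₁ h s, ⟨s, ⟨a, ha, hs⟩, rfl⟩, f₁ h s', ⟨s', ⟨a', ha', hs'⟩, rfl⟩, hp⟩

theorem rung_root : rung f₀ f₁ C S v = geodesicHull S := by
  ext p
  refine ⟨fun h => ?_, fun h => .root p h⟩
  -- The vertex index is generalised to allow case analysis; `step` cannot end at the root, which is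
  -- at distance 0.
  have key : ∀ w (q : Y w), Ladder f₀ f₁ C S w q → ∀ e : w = v, e ▸ q ∈ geodesicHull S := by
    intro w q hq
    cases hq with
    | root p hp => exact fun _ => hp
    | step h hc =>
      rintro rfl
      simp [IsChild] at hc
  exact key v p h rfl

/-- Uniqueness of parents turns the inductive definition into a recursion along the tree. -/
theorem rung_child (hG : G.IsTree) {u w : V} (h : G.Adj u w) (hc : IsChild G v u w) :
    rung f₀ f₁ C S w = geodesicHull (f₁ h '' nearSet C (f₀ h) (rung f₀ f₁ C S u)) := by
  ext p
  constructor
  · intro hp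
    rcases hp.inversion with ⟨-, h0⟩ | ⟨u', h', hc', hp'⟩
    · unfold IsChild at hc; omega
    · obtain rfl := hG.parent_unique h h' hc hc'
      exact hp'
  · rintro ⟨_, ⟨s, ⟨a, ha, hs⟩, rfl⟩, _, ⟨s', ⟨a', ha', hs'⟩, rfl⟩, hp⟩
    exact Ladder.step h hc s s' a a' ha ha' hs hs' p hp

theorem rung_eq_empty_of_parent (hG : G.IsTree) {u w : V} (h : G.Adj u w) (hc : IsChild G v u w)
    (hu : rung f₀ f₁ C S u = ∅) : rung f₀ f₁ C S w = ∅ := by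
  rw [rung_child hG h hc, hu]
  simp [nearSet, geodesicHull]

theorem nearSet_eq_empty_of_rung (hG : G.IsTree) {u w : V} (h : G.Adj u w) (hc : IsChild G v u w)
    (hw : rung f₀ f₁ C S w = ∅) : nearSet C (f₀ h) (rung f₀ f₁ C S u) = ∅ := by
  rw [rung_child hG h hc] at hw
  by_contra! hne
  obtain ⟨s, hs⟩ := hne
  have : f₁ h s ∈ (∅ : Set (Y w)) := hw ▸ subset_geodesicHull _ ⟨s, hs, rfl⟩
  exact this

/-- Each rung is a hull, so the constant does not deteriorate with the distance from the root. -/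
theorem isQuasiconvex_rung (hG : G.IsTree) (hY : ∀ u, IsHyperbolicSpace (Y u) δ) (hδ : 0 ≤ δ)
    (u : V) : IsQuasiconvex (8 * δ) (rung f₀ f₁ C S u) := by
  by_cases hu : u = v
  · subst hu
    rw [rung_root]
    exact (hY u).isQuasiconvex_geodesicHull hδ S
  · obtain ⟨w, h, hc⟩ := hG.exists_parent hu
    rw [rung_child hG h hc]
    exact (hY u).isQuasiconvex_geodesicHull hδ _

theorem Beyond.rung_eq_empty (hG : G.IsTree) {w : V} {z : X} (h : Beyond ι f₀ f₁ C c S w z) :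
    rung f₀ f₁ C S w = ∅ := by
  induction h with
  | base h hc he => exact he
  | step h hc z hz ih => exact rung_eq_empty_of_parent hG h hc ih

theorem Beyond.exists_rung {w : V} {z : X} (h : Beyond ι f₀ f₁ C c S w z) :
    ∃ u, ∃ a ∈ rung f₀ f₁ C S u, ι u a = z := by
  induction h with
  | base h hc he s a ha => exact ⟨_, a, ha.1, rfl⟩
  | step h hc z hz ih => exact ih

theorem IsLadderProj.exists_rung {w : V} {y : Y w} {z : X}
    (h : IsLadderProj ι f₀ f₁ C c S w y z) : ∃ u, ∃ a ∈ rung f₀ f₁ C S u, ι u a = z := by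
  rcases h with ⟨a, ha, rfl⟩ | h
  · exact ⟨w, a, ha.1, rfl⟩
  · exact h.exists_rung

variable [MetricSpace X] [∀ u w (h : G.Adj u w), MetricSpace (E h)]

/-- A tree of spaces, up to bounded error: `Y v` are the vertex spaces, `E h` the edge spaces,
`f₀ h` and `f₁ h` the two ends of an edge space. Any two points of different vertex spaces are
joined by a path crossing the edges one by one. -/
structure IsCoarseTree (ι : ∀ v, Y v → X) (f₀ : ∀ ⦃u w⦄ (h : G.Adj u w), E h → Y u)
    (f₁ : ∀ ⦃u w⦄ (h : G.Adj u w), E h → Y w) : Prop where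
  tree : G.IsTree
  dist_le : ∀ v x y, dist (ι v x) (ι v y) ≤ dist x y
  proper : ∀ M : ℝ, ∃ N : ℝ, 0 ≤ N ∧ ∀ v x y, dist (ι v x) (ι v y) ≤ M → dist x y ≤ N
  nonempty : ∀ u w (h : G.Adj u w), Nonempty (E h)
  near : ∀ x, ∃ v y, dist x (ι v y) ≤ 1
  edge : ∀ u w (h : G.Adj u w) s, dist (ι u (f₀ h s)) (ι w (f₁ h s)) ≤ 1
  cross : ∀ u u' (x : Y u) (y : Y u'), u ≠ u' → ∃ (w : V) (h : G.Adj u w) (a : Y u) (b : Y w),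
    dist (ι u x) (ι u a) ≤ dist (ι u x) (ι u' y) ∧
    dist (ι w b) (ι u' y) ≤ dist (ι u x) (ι u' y) - 1 ∧
    (∃ s s' : E h, dist (ι u a) (ι u (f₀ h s)) ≤ 1 ∧ dist (ι w b) (ι w (f₁ h s')) ≤ 1 ∧
      dist s s' ≤ dist (ι u x) (ι u' y)) ∧
    -- The same crossing in the oppositely oriented edge space, which is unrelated to `E h`: which
    -- of the two is needed depends on the root.
    (∃ s s' : E h.symm, dist (ι u a) (ι u (f₁ h.symm s)) ≤ 1 ∧
      dist (ι w b) (ι w (f₀ h.symm s')) ≤ 1 ∧ dist s s' ≤ dist (ι u x) (ι u' y))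

/-- Each crossing shortens the remaining distance by at least 1. -/
theorem IsCoarseTree.graphDist_le (T : IsCoarseTree ι f₀ f₁) {u u' : V} (x : Y u) (y : Y u') :
    (G.dist u u' : ℝ) ≤ dist (ι u x) (ι u' y) := by
  obtain ⟨n, hn⟩ := exists_nat_ge (dist (ι u x) (ι u' y))
  induction n generalizing u with
  | zero =>
    by_cases hu : u = u'
    · subst hu; simp
    · obtain ⟨w, h, a, b, -, hb, -⟩ := T.cross u u' x y hu
      have := dist_nonneg (x := ι w b) (y := ι u' y)
      push_cast at hn
      linarith
  | succ n ih =>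
    by_cases hu : u = u'
    · subst hu; simp
    · obtain ⟨w, h, a, b, -, hb, -⟩ := T.cross u u' x y hu
      have h1 := ih b (by push_cast at hn; linarith)
      have h2 := T.tree.1.dist_triangle (u := u) (v := w) (w := u')
      rw [SimpleGraph.dist_eq_one_iff_adj.2 h] at h2
      have : (G.dist u u' : ℝ) ≤ 1 + G.dist w u' := by exact_mod_cast h2
      linarith

/-- The hypotheses under which the ladder is studied. -/
structure LadderHyp (ι : ∀ v, Y v → X) (f₀ : ∀ ⦃u w⦄ (h : G.Adj u w), E h → Y u)
    (f₁ : ∀ ⦃u w⦄ (h : G.Adj u w), E h → Y w) (δ K ε C c : ℝ) : Prop where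
  tree : IsCoarseTree ι f₀ f₁
  hyperbolic : ∀ v, IsHyperbolicSpace (Y v) δ
  δ_nonneg : 0 ≤ δ
  C_nonneg : 0 ≤ C
  c_nonneg : 0 ≤ c
  step : ∀ u w (h : G.Adj u w), IsLadderStep δ C c (f₀ h) (f₁ h)
  K_nonneg : 0 ≤ K
  qi₀ : ∀ u w (h : G.Adj u w), IsQIEmbedding K ε (f₀ h)
  qi₁ : ∀ u w (h : G.Adj u w), IsQIEmbedding K ε (f₁ h)

/-! ### The coarse projection to the ladder and its quasiconvexity. -/

variable {K ε : ℝ}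

theorem LadderHyp.isQuasiconvex_rung (H : LadderHyp ι f₀ f₁ δ K ε C c) (u : V) :
    IsQuasiconvex (8 * δ) (rung f₀ f₁ C S u) :=
  _root_.isQuasiconvex_rung H.tree.tree H.hyperbolic H.δ_nonneg u

theorem LadderHyp.exists_isCoarseProj (H : LadderHyp ι f₀ f₁ δ K ε C c) {u : V}
    (hu : (rung f₀ f₁ C S u).Nonempty) (y : Y u) :
    ∃ a, IsCoarseProj (1 + 12 * δ) y (rung f₀ f₁ C S u) a := by
  obtain ⟨a, ha⟩ := (H.hyperbolic u).exists_isCoarseProj H.δ_nonneg (H.isQuasiconvex_rung u) hu y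
  exact ⟨a, by convert ha using 1; ring⟩

theorem LadderHyp.exists_beyond (H : LadderHyp ι f₀ f₁ δ K ε C c) (hS : S.Nonempty) (u : V)
    (hu : rung f₀ f₁ C S u = ∅) : ∃ z, Beyond ι f₀ f₁ C (1 + 12 * δ) S u z := by
  induction hn : G.dist v u generalizing u with
  | zero =>
    rw [H.tree.tree.1.dist_eq_zero_iff] at hn
    subst hn
    rw [rung_root] at hu
    exact absurd (hS.mono (subset_geodesicHull S)) (by simp [hu])
  | succ n ih =>
    have hne : u ≠ v := by rintro rfl; simp at hn
    obtain ⟨w, h, hc⟩ := H.tree.tree.exists_parent hne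
    rcases (rung f₀ f₁ C S w).eq_empty_or_nonempty with hw | hw
    · obtain ⟨z, hz⟩ := ih w hw (by unfold IsChild at hc; omega)
      exact ⟨z, .step h hc z hz⟩
    · obtain ⟨s⟩ := H.tree.nonempty _ _ h
      obtain ⟨a, ha⟩ := H.exists_isCoarseProj hw (f₀ h s)
      exact ⟨_, .base h hc hu s a ha⟩

theorem LadderHyp.exists_isLadderProj (H : LadderHyp ι f₀ f₁ δ K ε C c) (hS : S.Nonempty) (u : V)
    (y : Y u) : ∃ z, IsLadderProj ι f₀ f₁ C (1 + 12 * δ) S u y z := by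
  rcases (rung f₀ f₁ C S u).eq_empty_or_nonempty with hu | hu
  · obtain ⟨z, hz⟩ := H.exists_beyond hS u hu
    exact ⟨z, .inr hz⟩
  · obtain ⟨a, ha⟩ := H.exists_isCoarseProj hu y
    exact ⟨_, .inl ⟨a, ha, rfl⟩⟩

/-- Both points come from the same edge, the first one leading to an empty rung; there the whole
image of the edge space has projection of bounded diameter. The mixed cases would need a rung both
empty and nonempty. -/
theorem LadderHyp.dist_le_of_beyond (H : LadderHyp ι f₀ f₁ δ K ε C c) {u : V} {z z' : X}
    (hz : Beyond ι f₀ f₁ C (1 + 12 * δ) S u z) (hz' : Beyond ι f₀ f₁ C (1 + 12 * δ) S u z') :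
    dist z z' ≤ c := by
  induction hz with
  | base h hc he s a ha =>
    cases hz' with
    | base h' hc' he' s' a' ha' =>
      obtain rfl := H.tree.tree.parent_unique h h' hc hc'
      exact (H.tree.dist_le _ _ _).trans ((H.step _ _ h).dist_le_of_empty _
        (H.isQuasiconvex_rung _) (nearSet_eq_empty_of_rung H.tree.tree h hc he) s s' a a' ha ha')
    | step h' hc' z' hz' =>
      obtain rfl := H.tree.tree.parent_unique h h' hc hc'
      have := ha.1
      rw [hz'.rung_eq_empty H.tree.tree] at this
      exact this.elim
  | step h hc z hz ih =>
    cases hz' with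
    | base h' hc' he' s' a' ha' =>
      obtain rfl := H.tree.tree.parent_unique h h' hc hc'
      have := ha'.1
      rw [hz.rung_eq_empty H.tree.tree] at this
      exact this.elim
    | step h' hc' z' hz' =>
      obtain rfl := H.tree.tree.parent_unique h h' hc hc'
      exact ih hz'

theorem LadderHyp.dist_le_of_same (H : LadderHyp ι f₀ f₁ δ K ε C c) {u : V} {y y' : Y u}
    {z z' : X} (hz : IsLadderProj ι f₀ f₁ C (1 + 12 * δ) S u y z)
    (hz' : IsLadderProj ι f₀ f₁ C (1 + 12 * δ) S u y' z') {R : ℝ} (hR : dist y y' ≤ R) :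
    dist z z' ≤ 2 + 24 * δ + R + c := by
  have hδ := H.δ_nonneg
  have hc := H.c_nonneg
  have hR0 := dist_nonneg.trans hR
  rcases hz with ⟨a, ha, rfl⟩ | hz <;> rcases hz' with ⟨a', ha', rfl⟩ | hz'
  · linarith [H.tree.dist_le u a a', (ha.of_dist_le hR).dist_le ha']
  · have := ha.1
    rw [hz'.rung_eq_empty H.tree.tree] at this
    exact this.elim
  · have := ha'.1
    rw [hz.rung_eq_empty H.tree.tree] at this
    exact this.elim
  · linarith [H.dist_le_of_beyond hz hz']

/-- With both rungs nonempty this is the commutation of projections with the end maps. If the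
child's rung is empty, the projection at the parent is itself an admissible point beyond it. -/
theorem LadderHyp.dist_le_of_edge (H : LadderHyp ι f₀ f₁ δ K ε C c) {u w : V} (h : G.Adj u w)
    (hc : IsChild G v u w) (s : E h) {z z' : X}
    (hz : IsLadderProj ι f₀ f₁ C (1 + 12 * δ) S u (f₀ h s) z)
    (hz' : IsLadderProj ι f₀ f₁ C (1 + 12 * δ) S w (f₁ h s) z') : dist z z' ≤ 2 * c + 1 := by
  have hc0 := H.c_nonneg
  have key : ∀ z', Beyond ι f₀ f₁ C (1 + 12 * δ) S w z' → dist z z' ≤ c := by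
    intro z' hz'
    refine H.dist_le_of_beyond ?_ hz'
    rcases hz with ⟨a, ha, rfl⟩ | hz
    · exact .base h hc (hz'.rung_eq_empty H.tree.tree) s a ha
    · exact .step h hc z hz
  rcases hz' with ⟨a', ha', rfl⟩ | hz'
  · rcases hz with ⟨a, ha, rfl⟩ | hz
    · rw [rung_child H.tree.tree h hc] at ha'
      obtain ⟨q, hq, hq'⟩ := (H.step _ _ h).dist_proj_le _ (H.isQuasiconvex_rung u) s a a' ha ha'
      linarith [H.tree.dist_le u a (f₀ h q), H.tree.dist_le w (f₁ h q) a', H.tree.edge _ _ h q,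
        dist_triangle (ι u a) (ι u (f₀ h q)) (ι w a'),
        dist_triangle (ι u (f₀ h q)) (ι w (f₁ h q)) (ι w a')]
    · have := ha'.1
      rw [rung_eq_empty_of_parent H.tree.tree h hc (hz.rung_eq_empty H.tree.tree)] at this
      exact this.elim
  · linarith [key z' hz']

/-- Induction on the distance: the first edge crossing costs a bounded amount and leaves a distance
smaller by 1. The bound is uniform in `v` and `S`. -/
theorem LadderHyp.exists_dist_le (H : LadderHyp ι f₀ f₁ δ K ε C c) (n : ℕ) :
    ∃ R, ∀ (v : V) (S : Set (Y v)), S.Nonempty → ∀ u u' (y : Y u) (y' : Y u') z z',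
      dist (ι u y) (ι u' y') ≤ n → IsLadderProj ι f₀ f₁ C (1 + 12 * δ) S u y z →
      IsLadderProj ι f₀ f₁ C (1 + 12 * δ) S u' y' z' → dist z z' ≤ R := by
  have hδ := H.δ_nonneg
  have hc0 := H.c_nonneg
  induction n with
  | zero =>
    obtain ⟨N, hN0, hN⟩ := H.tree.proper 0
    refine ⟨2 + 24 * δ + N + c, fun v S hS u u' y y' z z' hd hz hz' => ?_⟩
    obtain rfl : u = u' := by
      by_contra hu
      obtain ⟨w, -, -, b, -, hb, -⟩ := H.tree.cross u u' y y' hu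
      push_cast at hd
      linarith [dist_nonneg (x := ι w b) (y := ι u' y')]
    exact H.dist_le_of_same hz hz' (hN _ _ _ (by simpa using hd))
  | succ n ih =>
    obtain ⟨R, hR⟩ := ih
    obtain ⟨N, hN0, hN⟩ := H.tree.proper (n + 1)
    obtain ⟨N₁, hN₁0, hN₁⟩ := H.tree.proper 1
    obtain ⟨A, hA⟩ : ∃ A, A = 2 + 24 * δ + N + c := ⟨_, rfl⟩
    obtain ⟨B, hB⟩ : ∃ B, B = 2 + 24 * δ + N₁ + c := ⟨_, rfl⟩
    obtain ⟨Q, hQ⟩ : ∃ Q, Q = 2 + 24 * δ + (K * (n + 1) + ε) + c := ⟨_, rfl⟩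
    refine ⟨|R| + A + 2 * B + |Q| + (2 * c + 1), fun v S hS u u' y y' z z' hd hz hz' => ?_⟩
    push_cast at hd
    by_cases hu : u = u'
    · subst hu
      have := H.dist_le_of_same hz hz' (hN _ _ _ hd)
      linarith [abs_nonneg R, abs_nonneg Q]
    obtain ⟨w, h, a, b, hxa, hby, ⟨s, s', hs, hs', hss⟩, ⟨t, t', ht, ht', htt⟩⟩ :=
      H.tree.cross u u' y y' hu
    obtain ⟨za, hza⟩ := H.exists_isLadderProj hS u a
    obtain ⟨zb, hzb⟩ := H.exists_isLadderProj hS w b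
    have e1 : dist z za ≤ A := hA ▸ H.dist_le_of_same hz hza (hN _ _ _ (hxa.trans hd))
    have e2 : dist zb z' ≤ R := hR v S hS w u' b y' zb z' (by linarith) hzb hz'
    have e3 : dist za zb ≤ 2 * B + |Q| + (2 * c + 1) := by
      -- The edge is to be read in the direction away from the root.
      rcases H.tree.tree.isChild_or_isChild v h with hc | hc
      · obtain ⟨p₁, hp₁⟩ := H.exists_isLadderProj hS u (f₀ h s)
        obtain ⟨p₂, hp₂⟩ := H.exists_isLadderProj hS w (f₁ h s)
        obtain ⟨p₃, hp₃⟩ := H.exists_isLadderProj hS w (f₁ h s')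
        have g1 : dist za p₁ ≤ B := hB ▸ H.dist_le_of_same hza hp₁ (hN₁ _ _ _ hs)
        have g2 := H.dist_le_of_edge h hc s hp₁ hp₂
        have g3 : dist p₂ p₃ ≤ Q := hQ ▸ H.dist_le_of_same hp₂ hp₃
          (((H.qi₁ _ _ h).dist_le s s').trans
            (by have := mul_le_mul_of_nonneg_left (hss.trans hd) H.K_nonneg; linarith))
        have g4 : dist zb p₃ ≤ B := hB ▸ H.dist_le_of_same hzb hp₃ (hN₁ _ _ _ hs')
        linarith [dist_triangle za p₁ zb, dist_triangle p₁ p₂ zb, dist_triangle p₂ p₃ zb,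
          dist_comm p₃ zb, le_abs_self Q]
      · obtain ⟨p₁, hp₁⟩ := H.exists_isLadderProj hS u (f₁ h.symm t)
        obtain ⟨p₂, hp₂⟩ := H.exists_isLadderProj hS w (f₀ h.symm t)
        obtain ⟨p₃, hp₃⟩ := H.exists_isLadderProj hS w (f₀ h.symm t')
        have g1 : dist za p₁ ≤ B := hB ▸ H.dist_le_of_same hza hp₁ (hN₁ _ _ _ ht)
        have g2 := H.dist_le_of_edge h.symm hc t hp₂ hp₁
        have g3 : dist p₂ p₃ ≤ Q := hQ ▸ H.dist_le_of_same hp₂ hp₃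
          (((H.qi₀ _ _ h.symm).dist_le t t').trans
            (by have := mul_le_mul_of_nonneg_left (htt.trans hd) H.K_nonneg; linarith))
        have g4 : dist zb p₃ ≤ B := hB ▸ H.dist_le_of_same hzb hp₃ (hN₁ _ _ _ ht')
        linarith [dist_triangle za p₁ zb, dist_triangle p₁ p₂ zb, dist_triangle p₂ p₃ zb,
          dist_comm p₃ zb, dist_comm p₁ p₂, le_abs_self Q]
    linarith [dist_triangle z za z', dist_triangle za zb z', le_abs_self R]

/-- Projecting a geodesic of `X` at integer times gives the chains required by
`exists_quasiconvex_of_chains`. -/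
theorem LadderHyp.exists_isQuasiconvex (H : LadderHyp ι f₀ f₁ δ K ε C c) {δX : ℝ} (hδX : 0 ≤ δX)
    (hX : IsHyperbolicSpace X δX) : ∃ D, ∀ (v : V) (S : Set (Y v)), S.Nonempty →
      IsQuasiconvex D {z | ∃ u, ∃ a ∈ rung f₀ f₁ C S u, ι u a = z} := by
  -- 3 = 1 + 1 + 1: consecutive points are at distance at most 1, and each is within 1 of a vertex
  -- space.
  obtain ⟨R, hR⟩ := H.exists_dist_le 3
  obtain ⟨D, -, hD⟩ := exists_quasiconvex_of_chains δX |R| 3 hδX (abs_nonneg R) (by norm_num)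
  have hδ := H.δ_nonneg
  refine ⟨D, fun v S hS => hD X hX _ ?_⟩
  rintro q hq q' hq'
  let P : X → X → Prop := fun x z =>
    ∃ u y, dist x (ι u y) ≤ 1 ∧ IsLadderProj ι f₀ f₁ C (1 + 12 * δ) S u y z
  have hP : ∀ x, ∃ z, P x z := fun x => by
    obtain ⟨u, y, hy⟩ := H.tree.near x
    obtain ⟨z, hz⟩ := H.exists_isLadderProj hS u y
    exact ⟨z, u, y, hy, hz⟩
  have hPd : ∀ x x' z z', dist x x' ≤ 1 → P x z → P x' z' → dist z z' ≤ |R| := by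
    rintro x x' z z' hxx ⟨u, y, hy, hz⟩ ⟨u', y', hy', hz'⟩
    refine (hR v S hS u u' y y' z z' ?_ hz hz').trans (le_abs_self R)
    push_cast
    linarith [dist_triangle (ι u y) x (ι u' y'), dist_triangle x x' (ι u' y'), dist_comm x (ι u y)]
  have hPs : ∀ q, (∃ u, ∃ a ∈ rung f₀ f₁ C S u, ι u a = q) → P q q := by
    rintro _ ⟨u, a, ha, rfl⟩
    exact ⟨u, a, by simp, .inl ⟨a, isCoarseProj_self (by positivity) ha, rfl⟩⟩
  choose g hg using hP
  obtain ⟨γ, h0, h1, hγ⟩ := hX.geodesic.exists_geodesic q q'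
  set L := dist q q' with hL
  have hL0 : 0 ≤ L := dist_nonneg
  have hn := Nat.le_ceil L
  have hn' := Nat.ceil_lt_add_one hL0
  set n := ⌈L⌉₊ with hn_def
  have hmem : ∀ i : ℕ, min (i : ℝ) L ∈ Icc 0 L := fun i =>
    ⟨le_min (Nat.cast_nonneg i) hL0, min_le_right _ _⟩
  -- The ends are inserted by hand, as the chosen projection `g q` need not be `q`; this shifts the
  -- times by one, and `min` stops the last one at L.
  refine ⟨n + 2, fun i => if i = 0 then q else if i = n + 2 then q' else
    g (γ (min ((i - 1 : ℕ) : ℝ) L)), by push_cast; linarith, by simp, by simp, fun i hi => ?_,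
    fun i hi => ?_⟩
  · rcases Nat.eq_zero_or_pos i with rfl | hi0
    · dsimp only
      rw [if_pos rfl, if_neg (by omega), if_neg (by omega)]
      refine hPd q _ _ _ ?_ (hPs q hq) (hg _)
      simp [hL0, h0]
    · dsimp only
      rw [if_neg hi0.ne', if_neg hi.ne, if_neg (Nat.succ_ne_zero i)]
      split_ifs with hi2
      · refine hPd _ q' _ _ ?_ (hg _) (hPs q' hq')
        have : i - 1 = n := by omega
        rw [this, min_eq_right hn, h1, dist_self]
        exact zero_le_one
      · refine hPd _ _ _ _ ?_ (hg _) (hg _)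
        rw [hγ _ (hmem _) _ (hmem _)]
        obtain ⟨j, rfl⟩ : ∃ j, i = j + 1 := ⟨i - 1, by omega⟩
        simp only [Nat.add_sub_cancel]
        refine (abs_min_sub_min_le_max _ _ _ _).trans ?_
        push_cast
        simp
  · dsimp only
    split_ifs
    · exact hq
    · exact hq'
    · obtain ⟨u, y, -, hz⟩ := hg (γ (min ((i - 1 : ℕ) : ℝ) L))
      exact hz.exists_rung

/-- The ladder over `S` is at linearly bounded height over the hull of `S`. -/
theorem LadderHyp.exists_dist_le_mul (H : LadderHyp ι f₀ f₁ δ K ε C c) {u : V} {p : Y u}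
    (hp : p ∈ rung f₀ f₁ C S u) :
    ∃ p₀ ∈ geodesicHull S, dist (ι u p) (ι v p₀) ≤ (c + 1 + C) * G.dist v u := by
  induction hn : G.dist v u generalizing u with
  | zero =>
    rw [H.tree.tree.1.dist_eq_zero_iff] at hn
    subst hn
    rw [rung_root] at hp
    exact ⟨p, hp, by simp⟩
  | succ n ih =>
    have hne : u ≠ v := by rintro rfl; simp at hn
    obtain ⟨w, h, hc⟩ := H.tree.tree.exists_parent hne
    rw [rung_child H.tree.tree h hc] at hp
    obtain ⟨q, ⟨a, ha, hqa⟩, hpq⟩ :=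
      (H.step _ _ h).exists_near _ (H.isQuasiconvex_rung w) p hp
    obtain ⟨p₀, hp₀, hd⟩ := ih ha (by unfold IsChild at hc; omega)
    refine ⟨p₀, hp₀, ?_⟩
    push_cast
    linarith [H.tree.dist_le u p (f₁ h q), H.tree.dist_le w (f₀ h q) a, H.tree.edge _ _ h q,
      dist_triangle (ι u p) (ι u (f₁ h q)) (ι v p₀), dist_comm (ι u (f₁ h q)) (ι w (f₀ h q)),
      dist_triangle (ι u (f₁ h q)) (ι w (f₀ h q)) (ι v p₀),
      dist_triangle (ι w (f₀ h q)) (ι w a) (ι v p₀)]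

/-- A small product in `X` gives a ladder point near `w`; descending to the root brings a point of
the hull of {x, y} near `w`, first in `X`, then by properness in `Y v`, where it bounds the product.
-/
theorem LadderHyp.exists_le_gromovProduct (H : LadderHyp ι f₀ f₁ δ K ε C c) {δX : ℝ}
    (hδX : 0 ≤ δX) (hX : IsHyperbolicSpace X δX) (v : V) (M : ℝ) : ∃ N, ∀ w x y : Y v,
      N ≤ gromovProduct w x y → M ≤ gromovProduct (ι v w) (ι v x) (ι v y) := by
  obtain ⟨D, hD⟩ := H.exists_isQuasiconvex hδX hX
  obtain ⟨N, hN0, hN⟩ := H.tree.proper ((c + 1 + C + 1) * (M + 4 * δX + D))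
  refine ⟨N + 1, fun w x y hxy => ?_⟩
  by_contra! hlt
  obtain ⟨z, hz, hwz⟩ := hX.exists_between_dist_le hδX (ι v w) (ι v x) (ι v y)
  have hroot : ∀ p ∈ ({x, y} : Set (Y v)), p ∈ rung f₀ f₁ C ({x, y} : Set (Y v)) v := by
    intro p hp
    rw [rung_root]
    exact subset_geodesicHull _ hp
  obtain ⟨_, ⟨u, a, ha, rfl⟩, hza⟩ := hD v {x, y} ⟨x, by simp⟩ _ ⟨v, x, hroot x (by simp), rfl⟩ _
    ⟨v, y, hroot y (by simp), rfl⟩ z hz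
  obtain ⟨p, hp, hap⟩ := H.exists_dist_le_mul ha
  have h1 := H.tree.graphDist_le w a
  have h2 : dist (ι v w) (ι u a) ≤ M + 4 * δX + D := by
    linarith [dist_triangle (ι v w) z (ι u a)]
  have h3 : dist w p ≤ N := hN _ _ _ (by
    have hc : 0 ≤ c + 1 + C := by linarith [H.c_nonneg, H.C_nonneg]
    have h4 := mul_le_mul_of_nonneg_left (h1.trans h2) hc
    linarith [dist_triangle (ι v w) (ι u a) (ι v p)])
  have h4 : gromovProduct w x y ≤ dist w p := by
    have hx := gromovProduct_le_dist_left w x y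
    have hy := gromovProduct_le_dist_left w y x
    rw [gromovProduct_comm] at hy
    -- The hull also contains the degenerate geodesics from `x` or `y` to itself, treated
    -- separately.
    obtain ⟨b, hb, b', hb', hp⟩ := hp
    have h5 := hp.gromovProduct_le w
    rcases hb with rfl | rfl <;> rcases hb' with rfl | rfl
    · rw [gromovProduct_eq_dist, dist_self] at h5; linarith
    · exact h5
    · rwa [gromovProduct_comm] at h5
    · rw [gromovProduct_eq_dist, dist_self] at h5; linarith
  linarith

end Ladder

/-! ### From Gromov products to a continuous extension. -/

section CannonThurston

variable {X Y : Type*} [MetricSpace X] [EMetricSpace Y] {f : Y → X}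

theorem tendsto_gromovProduct_comp
    (h : ∀ w M, ∃ N, ∀ x y, N ≤ gromovProduct w x y → M ≤ gromovProduct (f w) (f x) (f y))
    {x y : ℕ → Y}
    (hxy : ∀ w, Tendsto (fun p : ℕ × ℕ => gromovProduct w (x p.1) (y p.2)) atTop atTop) (w : X) :
    Tendsto (fun p : ℕ × ℕ => gromovProduct w (f (x p.1)) (f (y p.2))) atTop atTop := by
  refine tendsto_atTop.2 fun b => ?_
  obtain ⟨N, hN⟩ := h (x 0) (b + dist (f (x 0)) w)
  filter_upwards [tendsto_atTop.1 (hxy (x 0)) N] with p hp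
  linarith [hN _ _ hp, gromovProduct_le_add_dist_base (f (x 0)) w (f (x p.1)) (f (y p.2))]

/-- A map that is uniformly proper in terms of Gromov products extends continuously to the Gromov
compactifications. -/
theorem hasCannonThurstonMap_of_gromovProduct (hf : Continuous f)
    (h : ∀ w M, ∃ N, ∀ x y, N ≤ gromovProduct w x y → M ≤ gromovProduct (f w) (f x) (f y)) :
    HasCannonThurstonMap f := by
  let F : GromovSequence Y → GromovSequence X := fun s =>
    ⟨fun n => f (s.1 n), tendsto_gromovProduct_comp h s.2⟩
  let B : GromovBoundary Y → GromovBoundary X :=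
    Quot.map F fun s t hst => tendsto_gromovProduct_comp h hst
  let H : GromovCompactification Y → GromovCompactification X := fun z =>
    match z with
    | .of y => .of (f y)
    | .bdry ξ => .bdry (B ξ)
  have hrep : ∀ (x : ℕ → Y) z, GromovCompactification.Represents x z →
      GromovCompactification.Represents (fun n => f (x n)) (H z) := by
    rintro x (y | ξ) hx
    · exact fun n => congrArg f (hx n)
    · obtain ⟨s, rfl, rfl⟩ := hx
      exact ⟨F s, rfl, rfl⟩
  refine ⟨H, continuous_def.2 fun U hU => ⟨hU.1.preimage hf, fun ξ hξ w => ?_⟩, fun y => rfl⟩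
  obtain ⟨r, hr⟩ := hU.2 (B ξ) hξ (f w)
  -- The margin 1 restores the strict inequality lost in passing to the liminf.
  obtain ⟨N, hN⟩ := h w (r + 1)
  refine ⟨N, fun z hz => hr (H z) ?_⟩
  simp only [GromovCompactification.product, lt_iSup_iff] at hz
  obtain ⟨x, hx, y, hy, hlt⟩ := hz
  have hev := eventually_lt_of_lt_liminf hlt
  have hle : ((r + 1 : ℝ) : EReal) ≤ liminf (fun p : ℕ × ℕ =>
      ((gromovProduct (f w) (f (x p.1)) (f (y p.2)) : ℝ) : EReal)) atTop := by
    refine le_liminf_of_le (by isBoundedDefault) ?_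
    filter_upwards [hev] with p hp
    exact EReal.coe_le_coe_iff.2 (hN _ _ (EReal.coe_lt_coe_iff.1 hp).le)
  have hlt' : (r : EReal) < ((r + 1 : ℝ) : EReal) := EReal.coe_lt_coe_iff.2 (lt_add_one r)
  refine hlt'.trans_le (hle.trans ?_)
  unfold GromovCompactification.product
  exact le_iSup₂_of_le (fun n => f (x n)) (hrep x z hx)
    (le_iSup₂_of_le (fun n => f (y n)) (hrep y (.bdry ξ) hy) le_rfl)

end CannonThurston

/-! ### Lipschitz paths and the induced path metric. -/

section Geodesics

variable {X : Type*} [MetricSpace X]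

theorem rdist_comm {Y : Type*} [EMetricSpace Y] (x y : Y) : rdist x y = rdist y x := by
  simp only [rdist, edist_comm]

theorem IsGeodesicSpace.edist_ne_top {Y : Type*} [EMetricSpace Y] (h : IsGeodesicSpace Y)
    (x y : Y) : edist x y ≠ ⊤ := by
  obtain ⟨L, hL, γ, rfl, rfl, hγ⟩ := h x y
  rw [hγ 0 ⟨le_rfl, hL⟩ L ⟨hL, le_rfl⟩]
  exact ENNReal.ofReal_ne_top

/-- A geodesic space has finite distances. -/
abbrev IsGeodesicSpace.metricSpace {Y : Type*} [EMetricSpace Y] (h : IsGeodesicSpace Y) :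
    MetricSpace Y :=
  EMetricSpace.toMetricSpace h.edist_ne_top

/-- A geodesic extended by constants beyond both ends. -/
theorem IsGeodesicSpace.exists_lipschitzWith (h : IsGeodesicSpace X) (x y : X) :
    ∃ γ : ℝ → X, LipschitzWith 1 γ ∧ γ 0 = x ∧ γ (dist x y) = y := by
  obtain ⟨γ, h0, h1, hγ⟩ := h.exists_geodesic x y
  have hmem : ∀ t : ℝ, max 0 (min t (dist x y)) ∈ Icc 0 (dist x y) := fun t =>
    ⟨le_max_left _ _, max_le dist_nonneg (min_le_right _ _)⟩
  refine ⟨fun t => γ (max 0 (min t (dist x y))), LipschitzWith.of_dist_le_mul fun s t => ?_,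
    by simp [h0], by simp [h1]⟩
  rw [hγ _ (hmem s) _ (hmem t), NNReal.coe_one, one_mul, Real.dist_eq]
  refine (abs_max_sub_max_le_max _ _ _ _).trans (max_le (by simp) ?_)
  exact (abs_min_sub_min_le_max _ _ _ _).trans (max_le le_rfl (by simp))

theorem pathEDist_le_of_lipschitzWith {S : Set X} {γ : ℝ → X} (hγ : LipschitzWith 1 γ) {s t : ℝ}
    (hst : s ≤ t) (hS : ∀ r ∈ Icc s t, γ r ∈ S) :
    pathEDist S (γ s) (γ t) ≤ ENNReal.ofReal (t - s) := by
  let g : I → ℝ := fun θ => s + θ * (t - s)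
  have hg : Monotone g := fun a b hab => by
    have : (a : ℝ) ≤ b := hab
    have := mul_le_mul_of_nonneg_right this (sub_nonneg.2 hst)
    simp only [g]; linarith
  have hgc : Continuous g := by fun_prop
  let p : Path (γ s) (γ t) :=
    { toFun := γ ∘ g
      continuous_toFun := hγ.continuous.comp hgc
      source' := by simp [g]
      target' := by simp [g] }
  refine iInf₂_le_of_le p (fun θ => hS _ ⟨?_, ?_⟩) ?_
  · have := hg (unitInterval.nonneg' (t := θ))
    simpa [g] using this
  · have := hg (unitInterval.le_one' (t := θ))
    simpa [g] using this
  · have h1 := (hγ.lipschitzOnWith (s := univ)).comp_eVariationOn_le (mapsTo_univ g univ)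
    have h2 := ((hg.monotoneOn univ).eVariationOn_eq (mem_univ 0) (mem_univ 1)).le
    have h3 : (univ : Set I) ∩ Icc 0 1 = univ :=
      eq_univ_of_forall fun θ => ⟨trivial, unitInterval.nonneg', unitInterval.le_one'⟩
    rw [h3] at h2
    refine h1.trans ?_
    simpa [g] using h2

end Geodesics

/-! ### Barycentric coordinates on the tree. -/

section Realization

variable {V : Type*} {G : SimpleGraph V}

theorem vertexPoint_self (v : V) : vertexPoint v v = 1 := by simp [vertexPoint]

theorem vertexPoint_of_ne {v u : V} (h : u ≠ v) : vertexPoint v u = 0 := by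
  simp [vertexPoint, h]

theorem edgePoint_left {v w : V} (h : v ≠ w) (t : ℝ) : edgePoint v w t v = 1 - t := by
  simp [edgePoint, h]

theorem edgePoint_right {v w : V} (h : v ≠ w) (t : ℝ) : edgePoint v w t w = t := by
  simp [edgePoint, h.symm]

theorem edgePoint_of_ne {v w u : V} (h : u ≠ v) (h' : u ≠ w) (t : ℝ) : edgePoint v w t u = 0 := by
  simp [edgePoint, h, h']

theorem edgePoint_symm (v w : V) (t : ℝ) : edgePoint w v (1 - t) = edgePoint v w t := by
  simp only [edgePoint, sub_sub_cancel, add_comm]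

theorem edgePoint_zero (v w : V) : edgePoint v w 0 = vertexPoint v := by
  simp [edgePoint, vertexPoint]

theorem Realization.eq_vertexPoint_or {p : V → ℝ} (hp : p ∈ Realization G) :
    (∃ v, p = vertexPoint v) ∨ ∃ v w, G.Adj v w ∧ ∃ t ∈ Ioo (0 : ℝ) 1, p = edgePoint v w t := by
  rcases hp with h | ⟨v, w, h, t, ht, rfl⟩
  · exact .inl h
  · rcases ht.1.eq_or_lt with rfl | h0
    · exact .inl ⟨v, edgePoint_zero v w⟩
    rcases ht.2.eq_or_lt with rfl | h1
    · exact .inl ⟨w, by rw [← edgePoint_zero w v, ← edgePoint_symm v w, sub_self]⟩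
    exact .inr ⟨v, w, h, t, ⟨h0, h1⟩, rfl⟩

theorem Realization.mem_Icc {p : V → ℝ} (hp : p ∈ Realization G) (u : V) : p u ∈ Icc (0 : ℝ) 1 := by
  rcases hp with ⟨v, rfl⟩ | ⟨v, w, h, t, ht, rfl⟩
  · by_cases h : u = v
    · subst h; simp [vertexPoint_self]
    · simp [vertexPoint_of_ne h]
  · by_cases h1 : u = v
    · subst h1; rw [edgePoint_left h.ne]; exact ⟨by linarith [ht.2], by linarith [ht.1]⟩
    · by_cases h2 : u = w
      · subst h2; rwa [edgePoint_right h.ne]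
      · simp [edgePoint_of_ne h1 h2]

theorem Realization.eq_vertexPoint {p : V → ℝ} (hp : p ∈ Realization G) {u : V} (hu : p u = 1) :
    p = vertexPoint u := by
  rcases eq_vertexPoint_or hp with ⟨v, rfl⟩ | ⟨v, w, h, t, ht, rfl⟩
  · by_cases h : u = v
    · rw [h]
    · rw [vertexPoint_of_ne h] at hu; norm_num at hu
  · by_cases h1 : u = v
    · subst h1; rw [edgePoint_left h.ne] at hu; linarith [ht.1]
    · by_cases h2 : u = w
      · subst h2; rw [edgePoint_right h.ne] at hu; linarith [ht.2]
      · rw [edgePoint_of_ne h1 h2] at hu; norm_num at hu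

theorem Realization.exists_edgePoint {p : V → ℝ} (hp : p ∈ Realization G) {u : V}
    (h0 : p u ≠ 0) (h1 : p u ≠ 1) :
    ∃ w, G.Adj u w ∧ ∃ t ∈ Ioo (0 : ℝ) 1, p = edgePoint u w t := by
  rcases eq_vertexPoint_or hp with ⟨v, rfl⟩ | ⟨v, w, h, t, ht, rfl⟩
  · by_cases h : u = v
    · subst h; exact absurd (vertexPoint_self u) h1
    · exact absurd (vertexPoint_of_ne h) h0
  · by_cases e : u = v
    · subst e; exact ⟨w, h, t, ht, rfl⟩
    · by_cases e' : u = w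
      · subst e'
        exact ⟨v, h.symm, 1 - t, ⟨by linarith [ht.2], by linarith [ht.1]⟩,
          (edgePoint_symm v u t).symm⟩
      · exact absurd (edgePoint_of_ne e e' t) h0

theorem eq_of_edgePoint_ne_zero {u w w' : V} {t : ℝ} (hw : u ≠ w)
    (h : edgePoint u w' t w ≠ 0) : w' = w := by
  by_contra hne
  exact h (edgePoint_of_ne hw.symm (Ne.symm hne) t)

end Realization

/-! ### Paths crossing an edge of the tree. -/

section Crossing

variable {V : Type*} {G : SimpleGraph V} {X : Type*} {P : X → Realization G}

theorem openEdgeSpace_comm (P : X → Realization G) (u w : V) :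
    openEdgeSpace P u w = openEdgeSpace P w u := by
  have : ∀ u w, openEdgeSpace P u w ⊆ openEdgeSpace P w u := by
    rintro u w x ⟨t, ht, hx⟩
    exact ⟨1 - t, ⟨by linarith [ht.2], by linarith [ht.1]⟩, by rw [hx, edgePoint_symm]⟩
  exact (this u w).antisymm (this w u)

variable [MetricSpace X]

theorem continuous_coord (hP : Continuous P) (u : V) : Continuous fun x => (P x : V → ℝ) u :=
  (continuous_apply u).comp (continuous_subtype_val.comp hP)

/-- A path leaving a vertex space crosses an edge. -/
theorem exists_crossing (hP : Continuous P) {γ : ℝ → X} (hγ : Continuous γ) {L : ℝ} (hL : 0 ≤ L)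
    {u u' : V} (huu : u ≠ u') (h0 : γ 0 ∈ vertexSpace P u) (h1 : γ L ∈ vertexSpace P u') :
    ∃ w, G.Adj u w ∧ ∃ s t, 0 ≤ s ∧ s < t ∧ t ≤ L ∧ γ s ∈ vertexSpace P u ∧
      γ t ∈ vertexSpace P w ∧ ∀ r ∈ Ioo s t, γ r ∈ openEdgeSpace P u w := by
  let φ : V → ℝ → ℝ := fun v r => (P (γ r) : V → ℝ) v
  have hφ : ∀ v, Continuous (φ v) := fun v => (continuous_coord hP v).comp hγ
  have e0 : φ u 0 = 1 := by simp only [φ]; rw [h0, vertexPoint_self]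
  have e1 : φ u L = 0 := by simp only [φ]; rw [h1, vertexPoint_of_ne huu]
  -- `s` is the last time over `u` and `t` the first later time at which the `u`-coordinate
  -- vanishes; in between the path is over open edges at `u`.
  obtain ⟨s, ⟨hs, hs1⟩, hsmax⟩ := (isCompact_Icc.inter_right
    (isClosed_eq (hφ u) continuous_const)).exists_isGreatest (s := Icc 0 L ∩ {r | φ u r = 1})
    ⟨0, ⟨le_rfl, hL⟩, e0⟩
  obtain ⟨t, ⟨ht, ht0⟩, htmin⟩ := (isCompact_Icc.inter_right
    (isClosed_eq (hφ u) continuous_const)).exists_isLeast (s := Icc s L ∩ {r | φ u r = 0})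
    ⟨L, ⟨hs.2, le_rfl⟩, e1⟩
  rw [mem_ofPred_eq] at hs1 ht0
  have hst : s < t := lt_of_le_of_ne ht.1 (by rintro rfl; rw [hs1] at ht0; norm_num at ht0)
  have hne : ∀ r ∈ Ioo s t, φ u r ≠ 0 ∧ φ u r ≠ 1 := fun r hr =>
    ⟨fun h => (htmin ⟨⟨hr.1.le, hr.2.le.trans ht.2⟩, h⟩).not_gt hr.2,
      fun h => (hsmax ⟨⟨hs.1.trans hr.1.le, hr.2.le.trans ht.2⟩, h⟩).not_gt hr.1⟩
  have hmid : (s + t) / 2 ∈ Ioo s t := ⟨by linarith, by linarith⟩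
  obtain ⟨w, hw, τ, hτ, hmp⟩ :=
    Realization.exists_edgePoint (P (γ ((s + t) / 2))).2 (hne _ hmid).1 (hne _ hmid).2
  have hedge : ∀ r ∈ Ioo s t, φ w r ≠ 0 → ∃ τ ∈ Ioo (0 : ℝ) 1,
      (P (γ r) : V → ℝ) = edgePoint u w τ := by
    intro r hr hwr
    obtain ⟨w', hw', τ', hτ', hp⟩ :=
      Realization.exists_edgePoint (P (γ r)).2 (hne r hr).1 (hne r hr).2
    have : edgePoint u w' τ' w ≠ 0 := by rw [← hp]; exact hwr
    obtain rfl := eq_of_edgePoint_ne_zero hw.ne this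
    exact ⟨τ', hτ', hp⟩
  have hsum : ∀ r ∈ Ioo s t, φ w r ≠ 0 → φ u r + φ w r = 1 := by
    intro r hr hwr
    obtain ⟨τ, -, hp⟩ := hedge r hr hwr
    simp only [φ]
    rw [hp, edgePoint_left hw.ne, edgePoint_right hw.ne]; ring
  -- The path cannot switch edges: over `Ioo s t` the conditions "on the edge to `w`" and "on
  -- another edge" are both open, and the interval is connected.
  have hpos : ∀ r ∈ Ioo s t, φ w r ≠ 0 := by
    by_contra! hcon
    obtain ⟨r, hr, hr0⟩ := hcon
    obtain ⟨x, hx, hxU, hxU'⟩ := isPreconnected_Ioo (a := s) (b := t) {r | φ w r ≠ 0}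
      {r | φ u r + φ w r < 1} (isOpen_ne_fun (hφ w) continuous_const)
      (isOpen_lt ((hφ u).add (hφ w)) continuous_const) (fun x hx => by
        by_cases h : φ w x = 0
        · right
          have := (Realization.mem_Icc (P (γ x)).2 u).2
          simp only [mem_ofPred_eq, h, add_zero]
          exact lt_of_le_of_ne this (hne x hx).2
        · exact .inl h)
      ⟨_, hmid, by
        simp only [mem_ofPred_eq, φ]; rw [hmp, edgePoint_right hw.ne]; exact hτ.1.ne'⟩
      ⟨r, hr, by
        have := (Realization.mem_Icc (P (γ r)).2 u).2
        simp only [mem_ofPred_eq, hr0, add_zero]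
        exact lt_of_le_of_ne this (hne r hr).2⟩
    exact (hsum x hx hxU).not_lt hxU'
  have hcl : closure (Ioo s t) ⊆ {r | φ u r + φ w r = 1} :=
    closure_minimal (fun r hr => hsum r hr (hpos r hr))
      (isClosed_eq ((hφ u).add (hφ w)) continuous_const)
  rw [closure_Ioo hst.ne] at hcl
  have htw : φ w t = 1 := by
    have : φ u t + φ w t = 1 := hcl ⟨hst.le, le_rfl⟩
    linarith
  exact ⟨w, hw, s, t, hs.1, hst, ht.2, Realization.eq_vertexPoint (P (γ s)).2 hs1,
    Realization.eq_vertexPoint (P (γ t)).2 htw, fun r hr => hedge r hr (hpos r hr)⟩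

variable {K ε : ℝ} {u w : V} {f : PathSubspace (edgeSpace P u w) × I → X}
  {f₀ : PathSubspace (edgeSpace P u w) → PathSubspace (vertexSpace P u)}
  {f₁ : PathSubspace (edgeSpace P u w) → PathSubspace (vertexSpace P w)}

/-- The isometry is only given over the open interval; density and continuity carry the estimate to
the ends. -/
theorem IsEdgeMap.dist_le (hf : IsEdgeMap P K ε u w f f₀ f₁)
    (x : PathSubspace (edgeSpace P u w)) (s t : I) :
    dist (f (x, s)) (f (x, t)) ≤ |(s : ℝ) - t| := by
  have hd : DenseRange (Subtype.val : Ioo (0 : I) 1 → I) := by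
    rw [DenseRange, Subtype.range_coe, dense_iff_closure_eq, closure_Ioo zero_ne_one]
    exact eq_univ_of_forall fun θ => ⟨unitInterval.nonneg', unitInterval.le_one'⟩
  have hc := hf.continuous
  refine isClosed_property2 (p := fun s t : I => dist (f (x, s)) (f (x, t)) ≤ |(s : ℝ) - t|) hd
    (isClosed_le (by fun_prop) (by fun_prop)) ?_ s t
  rintro ⟨s, hs⟩ ⟨t, ht⟩
  have h1 := (edist_le_pathEDist _ _ _).trans_eq (hf.isometry x x s t ⟨hs.1, hs.2⟩ ⟨ht.1, ht.2⟩)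
  rw [edist_dist, ENNReal.ofReal_le_ofReal_iff (Real.sqrt_nonneg _)] at h1
  refine h1.trans_eq ?_
  simp [rdist, Real.sqrt_sq_eq_abs]

/-- Over the open edge both coordinates of the product metric change at most at unit speed. The tree
coordinate runs from 0 to 1, and the edge space coordinate moves by at most t - s. -/
theorem IsEdgeMap.exists_crossing (hf : IsEdgeMap P K ε u w f f₀ f₁) (hP : Continuous P)
    (huw : u ≠ w) {γ : ℝ → X} (hγ : LipschitzWith 1 γ) {s t : ℝ} (hst : s < t)
    (hs : γ s ∈ vertexSpace P u) (ht : γ t ∈ vertexSpace P w)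
    (hr : ∀ r ∈ Ioo s t, γ r ∈ openEdgeSpace P u w) :
    1 ≤ t - s ∧ ∃ x y, dist (γ s) (f (x, 0)) ≤ 1 ∧ dist (γ t) (f (y, 1)) ≤ 1 ∧
      rdist x y ≤ t - s := by
  let ψ : ℝ → ℝ := fun r => (P (γ r) : V → ℝ) w
  have hψ : Continuous ψ := (continuous_coord hP w).comp hγ.continuous
  have hψs : ψ s = 0 := by simp only [ψ]; rw [hs, vertexPoint_of_ne huw.symm]
  have hψt : ψ t = 1 := by simp only [ψ]; rw [ht, vertexPoint_self]
  have hex : ∀ r ∈ Ioo s t, ∃ x, ∃ τ : I, (τ : ℝ) ∈ Ioo (0 : ℝ) 1 ∧ f (x, τ) = γ r ∧ τ = ψ r := by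
    intro r hr'
    obtain ⟨x, τ, hτ, e⟩ := hf.surj _ (hr r hr')
    refine ⟨x, τ, hτ, e, ?_⟩
    simp only [ψ]
    rw [← e, hf.proj, edgePoint_right huw]
  have key : ∀ r ∈ Ioo s t, ∀ r' ∈ Ioo s t, r ≤ r' → ∀ x y (τ τ' : I), (τ : ℝ) ∈ Ioo (0 : ℝ) 1 →
      (τ' : ℝ) ∈ Ioo (0 : ℝ) 1 → f (x, τ) = γ r → f (y, τ') = γ r' →
      rdist x y ≤ r' - r ∧ |(τ : ℝ) - τ'| ≤ r' - r := by
    intro r h1 r' h2 hle x y τ τ' hτ hτ' e e'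
    have h3 := pathEDist_le_of_lipschitzWith hγ hle
      (fun q hq => hr q ⟨h1.1.trans_le hq.1, hq.2.trans_lt h2.2⟩)
    rw [← e, ← e', hf.isometry x y τ τ' hτ hτ',
      ENNReal.ofReal_le_ofReal_iff (sub_nonneg.2 hle)] at h3
    constructor
    · exact (Real.le_sqrt_of_sq_le (by nlinarith [sq_nonneg ((τ : ℝ) - τ')])).trans h3
    · exact (Real.abs_le_sqrt (by nlinarith [sq_nonneg (rdist x y)])).trans h3
  have hlip : LipschitzOnWith 1 ψ (Ioo s t) := by
    refine LipschitzOnWith.of_dist_le_mul fun r h1 r' h2 => ?_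
    obtain ⟨x, τ, hτ, e, hv⟩ := hex r h1
    obtain ⟨y, τ', hτ', e', hv'⟩ := hex r' h2
    rw [Real.dist_eq, Real.dist_eq, NNReal.coe_one, one_mul, ← hv, ← hv']
    rcases le_total r r' with h | h
    · exact (key r h1 r' h2 h x y τ τ' hτ hτ' e e').2.trans
        (by rw [abs_sub_comm]; exact le_abs_self _)
    · rw [abs_sub_comm]
      exact (key r' h2 r h1 h y x τ' τ hτ' hτ e' e).2.trans (le_abs_self _)
  refine ⟨?_, ?_⟩
  · rw [← lipschitzOnWith_closure_iff hψ.continuousOn, closure_Ioo hst.ne] at hlip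
    have := hlip.dist_le_mul t ⟨hst.le, le_rfl⟩ s ⟨le_rfl, hst.le⟩
    rwa [hψs, hψt, Real.dist_eq, Real.dist_eq, NNReal.coe_one, one_mul, sub_zero, abs_one,
      abs_of_pos (sub_pos.2 hst)] at this
  -- `γ s` need not be in the image of the edge map, so `x` is read off shortly after `s`, where
  -- this sum bounds the distance from `γ s` to `f (x, 0)`; similarly at `t`.
  · have ev1 : ∀ᶠ r in 𝓝[>] s, (r - s) + ψ r < 1 :=
      (((continuous_id.sub continuous_const).add hψ).continuousAt.eventually_lt
        continuousAt_const (by simp [hψs])).filter_mono nhdsWithin_le_nhds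
    have ev2 : ∀ᶠ r in 𝓝[<] t, (t - r) + (1 - ψ r) < 1 :=
      (((continuous_const.sub continuous_id).add
        (continuous_const.sub hψ)).continuousAt.eventually_lt
        continuousAt_const (by simp [hψt])).filter_mono nhdsWithin_le_nhds
    obtain ⟨r, hr1, hrs⟩ := (ev1.and (Ioo_mem_nhdsGT hst)).exists
    obtain ⟨r', hr1', hrt⟩ := (ev2.and (Ioo_mem_nhdsLT hst)).exists
    obtain ⟨x, τ, hτ, e, hv⟩ := hex r hrs
    obtain ⟨y, τ', hτ', e', hv'⟩ := hex r' hrt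
    refine ⟨x, y, ?_, ?_, ?_⟩
    · have h1 := hf.dist_le x τ 0
      have h2 := hγ.dist_le_mul s r
      rw [Real.dist_eq, NNReal.coe_one, one_mul, abs_sub_comm, abs_of_pos (sub_pos.2 hrs.1)] at h2
      rw [e, Icc.coe_zero, sub_zero, abs_of_pos hτ.1] at h1
      linarith [dist_triangle (γ s) (γ r) (f (x, 0))]
    · have h1 := hf.dist_le y τ' 1
      have h2 := hγ.dist_le_mul t r'
      rw [Real.dist_eq, NNReal.coe_one, one_mul, abs_of_pos (sub_pos.2 hrt.2)] at h2
      rw [e', Icc.coe_one, abs_sub_comm, abs_of_pos (sub_pos.2 hτ'.2)] at h1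
      linarith [dist_triangle (γ t) (γ r') (f (y, 1))]
    · rcases le_total r r' with h | h
      · linarith [(key r hrs r' hrt h x y τ τ' hτ hτ' e e').1, hrs.1, hrt.2]
      · have := (key r' hrt r hrs h y x τ' τ hτ' hτ e' e).1
        linarith [hrs.2, hrt.1, rdist_comm x y]

end Crossing

/-! ### A tree of spaces is a coarse tree. -/

section TreeOfSpaces

variable {V : Type*} {G : SimpleGraph V} {X : Type*} [MetricSpace X] {P : X → Realization G}

theorem rdist_incl_le {S : Set X} {x y : PathSubspace S} (h : edist x y ≠ ⊤) :
    dist x.incl y.incl ≤ rdist x y := by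
  rw [dist_edist]
  exact ENNReal.toReal_mono h (edist_le_pathEDist S x.incl y.incl)

theorem continuous_incl (S : Set X) : Continuous (PathSubspace.incl : PathSubspace S → X) :=
  (LipschitzWith.of_edist_le (f := (PathSubspace.incl : PathSubspace S → X))
    fun x y => edist_le_pathEDist S x.incl y.incl).continuous

theorem IsTreeOfHyperbolicSpacesWith.nonempty_edgeSpace {δ ε K : ℝ}
    (h : IsTreeOfHyperbolicSpacesWith G P δ ε K) {u w : V} (huw : G.Adj u w) :
    Nonempty (PathSubspace (edgeSpace P u w)) := by
  obtain ⟨x, hx⟩ := h.surjective ⟨edgePoint u w (1 / 2),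
    .inr ⟨u, w, huw, 1 / 2, by norm_num, rfl⟩⟩
  exact ⟨⟨x, congrArg Subtype.val hx⟩⟩

theorem IsTreeOfHyperbolicSpacesWith.exists_near {δ ε K : ℝ}
    (h : IsTreeOfHyperbolicSpacesWith G P δ ε K) (x : X) :
    ∃ v, ∃ y : PathSubspace (vertexSpace P v), dist x y.incl ≤ 1 := by
  rcases Realization.eq_vertexPoint_or (P x).2 with ⟨v, hv⟩ | ⟨v, w, hvw, t, ht, hx⟩
  · exact ⟨v, ⟨x, hv⟩, by simp⟩
  · obtain ⟨f, f₀, f₁, hf⟩ := h.edge_map v w hvw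
    obtain ⟨y, τ, hτ, rfl⟩ := hf.surj x ⟨t, ht, hx⟩
    refine ⟨v, f₀ y, ?_⟩
    rw [hf.left]
    refine (hf.dist_le y τ 0).trans ?_
    rw [Icc.coe_zero, sub_zero, abs_of_pos hτ.1]
    exact hτ.2.le

/-- The edge space of an edge, as a family indexed by adjacencies. -/
def AdjSpace (P : X → Realization G) ⦃u w : V⦄ (_ : G.Adj u w) : Type _ :=
  PathSubspace (edgeSpace P u w)

theorem IsTreeOfHyperbolicSpacesWith.exists_le_gromovProduct {δ ε K δX : ℝ}
    (h : IsTreeOfHyperbolicSpacesWith G P δ ε K) (hδ : 0 ≤ δ) (hε : 0 ≤ ε) (hK : 0 < K)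
    (hδX : 0 ≤ δX) (hX : IsHyperbolicSpace X δX) (v : V) (w : PathSubspace (vertexSpace P v))
    (M : ℝ) : ∃ N, ∀ x y : PathSubspace (vertexSpace P v), N ≤ gromovProduct w x y →
      M ≤ gromovProduct w.incl x.incl y.incl := by
  let (u : V) : MetricSpace (PathSubspace (vertexSpace P u)) :=
    (h.vertex_hyperbolic u).geodesic.metricSpace
  let (u w : V) (huw : G.Adj u w) : MetricSpace (AdjSpace P huw) :=
    (h.edge_hyperbolic u w huw).geodesic.metricSpace
  choose f f₀ f₁ hf using h.edge_map
  obtain ⟨C, c, hC, hc, hstep⟩ := exists_isLadderStep δ K ε hδ hK hε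
  have hT : IsCoarseTree (E := AdjSpace P)
      (fun u (x : PathSubspace (vertexSpace P u)) => x.incl) f₀ f₁ := by
    refine ⟨h.tree, fun u x y => rdist_incl_le ((h.vertex_hyperbolic u).geodesic.edist_ne_top x y),
      fun M => ?_, fun u w huw => h.nonempty_edgeSpace huw, h.exists_near, fun u w huw (s : PathSubspace _) => ?_,
      fun u u' x y huu => ?_⟩
    · obtain ⟨N, hN0, hN⟩ := h.uniformly_proper (max M 1) (by positivity)
      exact ⟨N, hN0.le, fun u x y hxy => hN u x y (hxy.trans (le_max_left _ _))⟩
    · have := (hf u w huw).dist_le s 0 1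
      rw [← (hf u w huw).left, ← (hf u w huw).right] at this
      simpa using this
    · obtain ⟨γ, hγ, h0, h1⟩ := hX.geodesic.exists_lipschitzWith x.incl y.incl
      obtain ⟨w, huw, s, t, hs, hst, htL, hγs, hγt, hr⟩ := exists_crossing h.continuous
        hγ.continuous dist_nonneg huu (h0 ▸ x.mem) (h1 ▸ y.mem)
      obtain ⟨hlen, a, b, ha, hb, hab⟩ :=
        (hf u w huw).exists_crossing h.continuous huw.ne hγ hst hγs hγt hr
      -- The edge map of the reversed edge is chosen independently, so the crossing is analysed
      -- again along the reversed path.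
      have hγ' : LipschitzWith 1 fun r => γ (-r) := LipschitzWith.of_dist_le_mul fun r r' => by
        simpa using hγ.dist_le_mul (-r) (-r')
      obtain ⟨-, a', b', ha', hb', hab'⟩ := (hf w u huw.symm).exists_crossing h.continuous
        huw.ne' hγ' (neg_lt_neg hst) (by simpa using hγt)
        (by simpa using hγs) (fun r hr' => by
          rw [openEdgeSpace_comm]
          exact hr (-r) ⟨lt_neg.2 hr'.2, neg_lt.2 hr'.1⟩)
      simp only [neg_neg] at ha' hb'
      have d1 := hγ.dist_le_mul 0 s
      have d2 := hγ.dist_le_mul t (dist x.incl y.incl)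
      rw [h0, Real.dist_eq, NNReal.coe_one, one_mul, zero_sub, abs_neg, abs_of_nonneg hs] at d1
      rw [h1, Real.dist_eq, NNReal.coe_one, one_mul, abs_sub_comm,
        abs_of_nonneg (sub_nonneg.2 htL)] at d2
      refine ⟨w, huw, ⟨γ s, hγs⟩, ⟨γ t, hγt⟩, ?_, ?_, ⟨a, b, ?_, ?_, ?_⟩, ⟨b', a', ?_, ?_, ?_⟩⟩
      · linarith
      · linarith
      · rw [(hf u w huw).left]; exact ha
      · rw [(hf u w huw).right]; exact hb
      · exact hab.trans (by linarith)
      · rw [(hf w u huw.symm).right]; exact hb'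
      · rw [(hf w u huw.symm).left]; exact ha'
      · exact (rdist_comm b' a').trans_le (hab'.trans (by linarith))
  have H : LadderHyp (E := AdjSpace P)
      (fun u (x : PathSubspace (vertexSpace P u)) => x.incl) f₀ f₁ δ K ε C c :=
    ⟨hT, h.vertex_hyperbolic, hδ, hC, hc, fun u w huw => hstep _ _ _ (h.edge_hyperbolic u w huw)
      (h.vertex_hyperbolic u) (h.vertex_hyperbolic w) _ _ (hf u w huw).qi_left
      (hf u w huw).qi_right, hK.le, fun u w huw => (hf u w huw).qi_left,
      fun u w huw => (hf u w huw).qi_right⟩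
  obtain ⟨N, hN⟩ := H.exists_le_gromovProduct hδX hX v M
  exact ⟨N, fun x y => hN w x y⟩

end TreeOfSpaces

theorem theorem3p8 {V X : Type*} [MetricSpace X] (G : SimpleGraph V) (P : X → Realization G)
    (hX : ∃ δ : ℝ, IsHyperbolicSpace X δ) (hP : IsTreeOfHyperbolicSpaces G P) (v : V) :
    HasCannonThurstonMap (PathSubspace.incl : PathSubspace (vertexSpace P v) → X) := by
  obtain ⟨δX, hX⟩ := hX
  obtain ⟨δ, hδ, ε, hε, K, hK, h⟩ := hP
  -- The constant `δX` has no given sign, so it is replaced by its maximum with 0.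
  exact hasCannonThurstonMap_of_gromovProduct (continuous_incl _) fun w M =>
    h.exists_le_gromovProduct hδ.le hε.le hK (le_max_right δX 0) (hX.mono (le_max_left δX 0)) v w M
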